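/- Let $d,k\ge 2$ be integers and let $\mathcal T=\mathcal T_{d,k}$ be the rooted tree whose root has $k$ children and in which every other vertex has $d$ children; let $\partial\mathcal T$ be its set of ends. An almost automorphism of $\mathcal T$ is a triple $(A,B,\varphi)$ where $A,B$ are finite subtrees containing the root and $\varphi:\mathcal T\setminus A\to\mathcal T\setminus B$ is an isomorphism of forests. Two almost automorphisms are identified if they coincide outside some finite subtree. Their classes form the Neretin group $\mathcal N_{d,k}$, which acts faithfully on $\partial\mathcal T$ and carries the unique group topology for which the automorphism group of the rooted tree $\mathcal T$, with its profinite topology, is an open subgroup. Let $O=\mathcal O_{d,k}\le\mathcal N_{d,k}$ be the subgroup, with the subspace topology, of all elements represented by an almost automorphism $(A,A,\varphi)$ with $A$ a ball around the root. Then the proper closed cocompact subgroups of $O$ are exactly the stabilizers of ends. That is, a subgroup $H\le O$ satisfies $H\neq O$, $H$ closed in $O$, and $O/H$ compact in the quotient topology, if and only if $H=O_\xi=\{g\in O: g\xi=\xi\}$ for some $\xi\in\partial\mathcal T$. -/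

import Mathlib

namespace NeretinTree

/-- Vertices of the rooted tree in which the root has `k` children and every other vertex has
`d` children. `none` is the root; `some (i, l)` is the vertex reached from the root through its
`i`-th child and then along the letters of `l`, the most recent letter standing first. -/
abbrev Vertex (d k : ℕ) : Type := Option (Fin k × List (Fin d))

variable {d k : ℕ}

/-- `IsParent u v`: the vertex `u` is the parent of `v`, that is, `v` is a child of `u`. -/
inductive IsParent : Vertex d k → Vertex d k → Prop
  | root (i : Fin k) : IsParent none (some (i, []))
  | cons (i : Fin k) (l : List (Fin d)) (a : Fin d) : IsParent (some (i, l)) (some (i, a :: l))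

/-- The distance of a vertex from the root. -/
def level : Vertex d k → ℕ
  | none => 0
  | some (_, l) => l.length + 1

/-- The ball of radius `n` around the root. -/
def ball (d k n : ℕ) : Set (Vertex d k) := {v | level v ≤ n}

/-- Ends of the tree, realised as the infinite geodesic rays that start at the root. -/
@[ext] structure Ends (d k : ℕ) : Type where
  /-- The vertex at distance `n` from the root on the ray. -/
  ray : ℕ → Vertex d k
  ray_zero : ray 0 = none
  isParent_ray : ∀ n, IsParent (ray n) (ray (n + 1))

/-- The vertex `v` lies on the ray from the root to the end `ξ`, that is, `ξ` is an end of the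
subtree of all vertices separated from the root by `v`. -/
def OnRay (v : Vertex d k) (ξ : Ends d k) : Prop := ∃ n, ξ.ray n = v

/-- Finite subtrees containing the root: finite sets of vertices that contain the root and with
every vertex its parent. -/
structure IsFiniteRootedSubtree (A : Set (Vertex d k)) : Prop where
  finite : A.Finite
  root_mem : none ∈ A
  parent_mem : ∀ u v, IsParent u v → v ∈ A → u ∈ A

/-- Isomorphisms from the forest `T \ A` to the forest `T \ B`: bijections between the vertices
outside `A` and those outside `B` that preserve the parent relation in both directions. (When `A`
and `B` are subtrees containing the root, this is the same as a graph isomorphism, as the vertices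
without a parent in the forest are exactly those of degree `d`, all others having degree
`d + 1`.) -/
abbrev ForestIso (A B : Set (Vertex d k)) : Type :=
  (fun u v : ↥(Aᶜ) => IsParent u.1 v.1) ≃r (fun u v : ↥(Bᶜ) => IsParent u.1 v.1)

/-- `g` is the map induced by the forest isomorphism `φ` on the ends of the tree. -/
def ForestIso.Induces {A B : Set (Vertex d k)} (φ : ForestIso A B)
    (g : Equiv.Perm (Ends d k)) : Prop :=
  ∀ (ξ : Ends d k) (v : ↥(Aᶜ)), OnRay v.1 ξ ↔ OnRay (φ v).1 (g ξ)

/-- Automorphisms of the rooted tree. -/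
abbrev TreeAut (d k : ℕ) : Type :=
  (IsParent : Vertex d k → Vertex d k → Prop) ≃r (IsParent : Vertex d k → Vertex d k → Prop)

/-- `g` is the map induced by the tree automorphism `α` on the ends of the tree. -/
def TreeAut.Induces (α : TreeAut d k) (g : Equiv.Perm (Ends d k)) : Prop :=
  ∀ (ξ : Ends d k) (v : Vertex d k), OnRay v ξ ↔ OnRay (α v) (g ξ)

theorem IsParent.level_eq {u v : Vertex d k} (h : IsParent u v) : level v = level u + 1 := by
  cases h <;> simp [level]

theorem IsParent.unique {u u' v : Vertex d k} (h : IsParent u v) (h' : IsParent u' v) :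
    u = u' := by
  cases h <;> cases h' <;> rfl

theorem exists_isParent {v : Vertex d k} (h : v ≠ none) : ∃ u, IsParent u v := by
  match v, h with
  | some (i, []), _ => exact ⟨none, .root i⟩
  | some (i, a :: l), _ => exact ⟨some (i, l), .cons i l a⟩

theorem ball_finite (d k n : ℕ) : (ball d k n).Finite := by
  have h : (Set.univ ×ˢ {l : List (Fin d) | l.length < n} : Set (Fin k × List (Fin d))).Finite :=
    Set.finite_univ.prod (List.finite_length_lt (Fin d) n)
  refine ((h.image some).insert none).subset ?_
  rintro (_ | ⟨i, l⟩) hv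
  · simp
  · right
    exact ⟨(i, l), ⟨trivial, Nat.lt_of_succ_le hv⟩, rfl⟩

theorem isFiniteRootedSubtree_ball (d k n : ℕ) : IsFiniteRootedSubtree (ball d k n) where
  finite := ball_finite d k n
  root_mem := Nat.zero_le n
  parent_mem u v h hv := by
    have := h.level_eq
    simp only [ball, Set.mem_ofPred_eq] at hv ⊢
    omega

theorem ForestIso.Induces.symm {A B : Set (Vertex d k)} {φ : ForestIso A B}
    {g : Equiv.Perm (Ends d k)} (h : φ.Induces g) : ForestIso.Induces (RelIso.symm φ) g⁻¹ := by
  intro ξ v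
  have := h (g⁻¹ ξ) (RelIso.symm φ v)
  simpa using this.symm

/-- Composition of almost automorphisms, after enlarging the subtrees that are removed. -/
theorem ForestIso.Induces.exists_comp {A B C D : Set (Vertex d k)}
    (hA : IsFiniteRootedSubtree A) (hB : IsFiniteRootedSubtree B)
    (hC : IsFiniteRootedSubtree C) (hD : IsFiniteRootedSubtree D)
    {φ : ForestIso A B} {ψ : ForestIso C D} {g h : Equiv.Perm (Ends d k)}
    (hφ : φ.Induces g) (hψ : ψ.Induces h) :
    ∃ (A' B' : Set (Vertex d k)) (χ : ForestIso A' B'), IsFiniteRootedSubtree A' ∧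
      IsFiniteRootedSubtree B' ∧ χ.Induces (g * h) := by
  have key : ∀ {A B C : Set (Vertex d k)} (_ : IsFiniteRootedSubtree A)
      (_ : IsFiniteRootedSubtree C) (φ : ForestIso A B),
      IsFiniteRootedSubtree {v | ∀ hv : v ∈ Aᶜ, (φ ⟨v, hv⟩).1 ∈ C} := by
    intro A B C hA hC φ
    refine ⟨?_, fun hv => absurd hA.root_mem hv, ?_⟩
    · have : {v | ∀ hv : v ∈ Aᶜ, (φ ⟨v, hv⟩).1 ∈ C} ⊆
          A ∪ Subtype.val '' ((fun v => (φ v).1) ⁻¹' C) := by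
        intro v hv
        by_cases hvA : v ∈ A
        · exact Or.inl hvA
        · exact Or.inr ⟨⟨v, hvA⟩, hv hvA, rfl⟩
      refine Set.Finite.subset (hA.finite.union (Set.Finite.image _ ?_)) this
      exact hC.finite.preimage (Subtype.val_injective.comp φ.injective).injOn
    · intro u v huv hv hu
      by_cases hvA : v ∈ A
      · exact absurd (hA.parent_mem u v huv hvA) hu
      · have h1 : IsParent (φ ⟨u, hu⟩).1 (φ ⟨v, hvA⟩).1 := φ.map_rel_iff.2 huv
        exact hC.parent_mem _ _ h1 (hv hvA)
  have hmem : ∀ {A B C : Set (Vertex d k)} {φ : ForestIso A B} {v : Vertex d k},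
      v ∈ {v | ∀ hv : v ∈ Aᶜ, (φ ⟨v, hv⟩).1 ∈ C}ᶜ ↔ ∃ hv : v ∈ Aᶜ, (φ ⟨v, hv⟩).1 ∈ Cᶜ := by
    intro A B C φ v
    simp only [Set.mem_compl_iff, Set.mem_ofPred_eq, not_forall]
  let χ : ForestIso {v | ∀ hv : v ∈ Cᶜ, (ψ ⟨v, hv⟩).1 ∈ A}
      {v | ∀ hv : v ∈ Bᶜ, (RelIso.symm φ ⟨v, hv⟩).1 ∈ D} :=
    { toFun := fun v =>
        ⟨(φ ⟨(ψ ⟨v.1, (hmem.1 v.2).1⟩).1, (hmem.1 v.2).2⟩).1,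
          hmem.2 ⟨(φ _).2, by simp⟩⟩
      invFun := fun v =>
        ⟨(RelIso.symm ψ ⟨(RelIso.symm φ ⟨v.1, (hmem.1 v.2).1⟩).1, (hmem.1 v.2).2⟩).1,
          hmem.2 ⟨(RelIso.symm ψ _).2, by simp⟩⟩
      left_inv := fun v => by simp
      right_inv := fun v => by simp
      map_rel_iff' := fun {u v} => by
        change IsParent (φ _).1 (φ _).1 ↔ IsParent u.1 v.1
        rw [φ.map_rel_iff]
        exact ψ.map_rel_iff }
  exact ⟨_, _, χ, key hC hA ψ, key hB hD (RelIso.symm φ),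
    fun ξ v => (hψ ξ ⟨v.1, (hmem.1 v.2).1⟩).trans (hφ (h ξ) ⟨_, (hmem.1 v.2).2⟩)⟩

/-- Almost automorphisms of the tree, identified when they agree outside a finite subtree. For
`d ≥ 2` two almost automorphisms are identified exactly when they induce the same permutation of
the ends, so the classes are represented by these permutations. -/
def neretinSubgroup (d k : ℕ) : Subgroup (Equiv.Perm (Ends d k)) where
  carrier := {g | ∃ (A B : Set (Vertex d k)) (φ : ForestIso A B),
    IsFiniteRootedSubtree A ∧ IsFiniteRootedSubtree B ∧ φ.Induces g}
  one_mem' := ⟨ball d k 0, ball d k 0, RelIso.refl _, isFiniteRootedSubtree_ball d k 0,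
    isFiniteRootedSubtree_ball d k 0, fun _ _ => Iff.rfl⟩
  mul_mem' := by
    rintro g h ⟨A, B, φ, hA, hB, hφ⟩ ⟨C, D, ψ, hC, hD, hψ⟩
    exact hφ.exists_comp hA hB hC hD hψ
  inv_mem' := by
    rintro g ⟨A, B, φ, hA, hB, hφ⟩
    exact ⟨B, A, RelIso.symm φ, hB, hA, hφ.symm⟩

/-- The Neretin group of almost automorphisms of the tree; it acts on the ends, as a group of
permutations of them. -/
abbrev NeretinGroup (d k : ℕ) : Type := ↥(neretinSubgroup d k)

/-- The subgroup of the Neretin group that consists of the automorphisms of the rooted tree fixing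
the ball of radius `n` pointwise; for `n = 0` this is the whole automorphism group of the rooted
tree. -/
def ballFixator (d k n : ℕ) : Subgroup (NeretinGroup d k) where
  carrier := {g | ∃ α : TreeAut d k, (∀ v ∈ ball d k n, α v = v) ∧ α.Induces g.1}
  one_mem' := ⟨RelIso.refl _, fun _ _ => rfl, fun _ _ => Iff.rfl⟩
  mul_mem' := by
    rintro g h ⟨α, hα, hg⟩ ⟨β, hβ, hh⟩
    exact ⟨β.trans α, fun v hv => by simp [hβ v hv, hα v hv],
      fun ξ v => (hh ξ v).trans (hg _ _)⟩
  inv_mem' := by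
    rintro g ⟨α, hα, hg⟩
    refine ⟨RelIso.symm α, fun v hv => by rw [RelIso.symm_apply_eq, hα v hv], fun ξ v => ?_⟩
    have := hg (g.1⁻¹ ξ) (RelIso.symm α v)
    simpa using this.symm

theorem ballFixator_anti {m n : ℕ} (h : m ≤ n) : ballFixator d k n ≤ ballFixator d k m := by
  rintro g ⟨α, hα, hg⟩
  exact ⟨α, fun v hv => hα v (le_trans hv h), hg⟩

theorem level_ray (ξ : Ends d k) (n : ℕ) : level (ξ.ray n) = n := by
  induction n with
  | zero => rw [ξ.ray_zero]; rfl
  | succ n ih => rw [(ξ.isParent_ray n).level_eq, ih]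

theorem onRay_iff {v : Vertex d k} {ξ : Ends d k} : OnRay v ξ ↔ ξ.ray (level v) = v := by
  refine ⟨?_, fun h => ⟨_, h⟩⟩
  rintro ⟨n, rfl⟩
  rw [level_ray]

theorem ray_eq_of_le {ξ η : Ends d k} {n : ℕ} (h : ξ.ray n = η.ray n) {m : ℕ} (hm : m ≤ n) :
    ξ.ray m = η.ray m := by
  induction n with
  | zero => rwa [Nat.le_zero.1 hm]
  | succ n ih =>
    rcases Nat.le_succ_iff.1 hm with hm | rfl
    · exact ih ((h ▸ ξ.isParent_ray n).unique (η.isParent_ray n)) hm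
    · exact h

theorem exists_subset_ball {A : Set (Vertex d k)} (hA : A.Finite) : ∃ n, A ⊆ ball d k n := by
  obtain ⟨n, hn⟩ := (hA.image level).bddAbove
  exact ⟨n, fun v hv => hn ⟨v, hv, rfl⟩⟩

theorem IsFiniteRootedSubtree.ray_mem {B : Set (Vertex d k)} (hB : IsFiniteRootedSubtree B)
    (ξ : Ends d k) {m n : ℕ} (hmn : m ≤ n) (h : ξ.ray n ∈ B) : ξ.ray m ∈ B := by
  induction n with
  | zero => rwa [Nat.le_zero.1 hmn]
  | succ n ih =>
    rcases Nat.le_succ_iff.1 hmn with hm | rfl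
    · exact ih hm (hB.parent_mem _ _ (ξ.isParent_ray n) h)
    · exact h

/-- Every ray leaves a finite subtree. -/
theorem IsFiniteRootedSubtree.exists_exit {B : Set (Vertex d k)} (hB : IsFiniteRootedSubtree B)
    (ξ : Ends d k) : ∃ n, ξ.ray n ∈ B ∧ ξ.ray (n + 1) ∉ B := by
  classical
  obtain ⟨N, hN⟩ := exists_subset_ball hB.finite
  have hex : ∃ n, ξ.ray n ∉ B := ⟨N + 1, fun h => by
    have := hN h
    simp only [ball, Set.mem_ofPred_eq, level_ray] at this
    omega⟩
  obtain ⟨n, hn⟩ : ∃ n, Nat.find hex = n + 1 := by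
    refine Nat.exists_eq_succ_of_ne_zero fun h0 => ?_
    have := Nat.find_spec hex
    rw [h0, ξ.ray_zero] at this
    exact this hB.root_mem
  refine ⟨n, ?_, hn ▸ Nat.find_spec hex⟩
  have := Nat.find_min hex (m := n) (by omega)
  simpa using this

/-- An automorphism of the forest `T \ B` that fixes the children of the vertices of `B` extends
by the identity on `B` to an automorphism of the tree. -/
theorem ForestIso.Induces.exists_extend {B : Set (Vertex d k)} (hB : IsFiniteRootedSubtree B)
    {χ : ForestIso B B} {g : Equiv.Perm (Ends d k)} (hχ : χ.Induces g)
    (hfix : ∀ (w : ↥(Bᶜ)) (u : Vertex d k), u ∈ B → IsParent u w.1 → χ w = w) :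
    ∃ α : TreeAut d k, (∀ v ∈ B, α v = v) ∧ (∀ v : ↥(Bᶜ), α v.1 = (χ v).1) ∧ α.Induces g := by
  classical
  let e : Equiv.Perm (Vertex d k) := Equiv.Perm.ofSubtype (p := (· ∈ Bᶜ)) χ.toEquiv
  have he1 : ∀ v ∈ B, e v = v := fun v hv =>
    Equiv.Perm.ofSubtype_apply_of_not_mem _ (fun h => h hv)
  have he2 : ∀ v : ↥(Bᶜ), e v.1 = (χ v).1 := fun v => Equiv.Perm.ofSubtype_apply_coe _ v
  have hrel : ∀ u v, IsParent (e u) (e v) ↔ IsParent u v := by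
    intro u v
    by_cases hu : u ∈ B <;> by_cases hv : v ∈ B
    · rw [he1 u hu, he1 v hv]
    · rw [he1 u hu, he2 ⟨v, hv⟩]
      constructor
      · intro h
        have h1 := hfix (χ ⟨v, hv⟩) u hu h
        rwa [χ.injective h1] at h
      · intro h
        rwa [hfix ⟨v, hv⟩ u hu h]
    · rw [he2 ⟨u, hu⟩, he1 v hv]
      exact ⟨fun h => absurd (hB.parent_mem _ _ h hv) (χ ⟨u, hu⟩).2,
        fun h => absurd (hB.parent_mem _ _ h hv) hu⟩
    · rw [he2 ⟨u, hu⟩, he2 ⟨v, hv⟩]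
      exact χ.map_rel_iff
  refine ⟨⟨e, hrel _ _⟩, he1, he2, fun ξ v => ?_⟩
  by_cases hv : v ∈ B
  · change _ ↔ OnRay (e v) _
    rw [he1 v hv]
    obtain ⟨n, hn, hn'⟩ := hB.exists_exit ξ
    have hon : OnRay (ξ.ray (n + 1)) (g ξ) := by
      have := (hχ ξ ⟨_, hn'⟩).1 ⟨n + 1, rfl⟩
      rwa [hfix ⟨_, hn'⟩ _ hn (ξ.isParent_ray n)] at this
    rw [onRay_iff, level_ray] at hon
    rw [onRay_iff, onRay_iff]
    have hle : ∀ η : Ends d k, η.ray (n + 1) = ξ.ray (n + 1) → η.ray (level v) = v →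
        level v ≤ n + 1 := by
      intro η h1 h2
      by_contra hlt
      exact hn' (h1 ▸ hB.ray_mem η (not_le.1 hlt).le (by rwa [h2]))
    constructor
    · intro h
      rw [ray_eq_of_le hon (hle ξ rfl h), h]
    · intro h
      rw [← ray_eq_of_le hon (hle _ hon h), h]
  · exact (hχ ξ ⟨v, hv⟩).trans (by rw [← he2 ⟨v, hv⟩]; rfl)

theorem exists_ballFixator_conj (g : NeretinGroup d k) (n : ℕ) :
    ∃ m, ∀ u ∈ ballFixator d k m, g * u * g⁻¹ ∈ ballFixator d k n := by
  obtain ⟨A, B, φ, hA, hB, hφ⟩ := g.2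
  obtain ⟨N₀, hN₀⟩ := exists_subset_ball hB.finite
  obtain ⟨M, hM⟩ := exists_subset_ball (hA.finite.union
    (Set.Finite.image (fun w : ↥(Bᶜ) => (RelIso.symm φ w).1)
      ((ball_finite d k (max N₀ n + 1)).preimage Subtype.val_injective.injOn)))
  refine ⟨M, ?_⟩
  rintro u ⟨α, hα, hu⟩
  have hαA : ∀ v ∈ A, α v = v := fun v hv => hα v (hM (Or.inl hv))
  have hαA' : ∀ v, α v ∈ Aᶜ ↔ v ∈ Aᶜ := fun v => by
    refine not_congr ⟨fun h => ?_, fun h => by rwa [hαA v h]⟩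
    have := hαA _ h
    rwa [α.injective this] at h
  let ψ : ForestIso A A :=
    ⟨α.toEquiv.subtypeEquiv fun v => (hαA' v).symm, α.map_rel_iff⟩
  have hψ : ψ.Induces u.1 := fun ξ v => hu ξ v.1
  let χ : ForestIso B B := (RelIso.symm φ).trans (ψ.trans φ)
  have hχ : χ.Induces (g * u * g⁻¹).1 := fun ξ v =>
    (hφ.symm ξ v).trans ((hψ _ _).trans (hφ _ _))
  have hlow : ∀ w : ↥(Bᶜ), w.1 ∈ ball d k (max N₀ n + 1) → χ w = w := by
    intro w hw
    have : ψ (RelIso.symm φ w) = RelIso.symm φ w :=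
      Subtype.ext (hα _ (hM (Or.inr ⟨w, hw, rfl⟩)))
    change φ (ψ (RelIso.symm φ w)) = w
    rw [this, RelIso.apply_symm_apply]
  obtain ⟨β, hβ1, hβ2, hβ⟩ := hχ.exists_extend hB fun w v hv hvw => hlow w (by
    have h1 := hN₀ hv
    have h2 := hvw.level_eq
    simp only [ball, Set.mem_ofPred_eq] at h1 ⊢
    omega)
  refine ⟨β, fun v hv => ?_, hβ⟩
  by_cases hvB : v ∈ B
  · exact hβ1 v hvB
  · rw [hβ2 ⟨v, hvB⟩, hlow ⟨v, hvB⟩ (by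
      simp only [ball, Set.mem_ofPred_eq] at hv ⊢
      omega)]

/-- The fixators of balls in the automorphism group of the rooted tree form a neighbourhood basis
of the identity for the profinite topology of that group; here they are used as a basis of
neighbourhoods of the identity in the Neretin group. -/
@[reducible] def neretinBasis (d k : ℕ) : GroupFilterBasis (NeretinGroup d k) where
  sets := Set.range fun n => (ballFixator d k n : Set (NeretinGroup d k))
  nonempty := Set.range_nonempty _
  inter_sets := by
    rintro _ _ ⟨m, rfl⟩ ⟨n, rfl⟩
    exact ⟨_, ⟨max m n, rfl⟩, Set.subset_inter (ballFixator_anti (le_max_left m n))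
      (ballFixator_anti (le_max_right m n))⟩
  one' := by
    rintro _ ⟨n, rfl⟩
    exact one_mem _
  mul' := by
    rintro _ ⟨n, rfl⟩
    refine ⟨_, ⟨n, rfl⟩, ?_⟩
    rintro _ ⟨x, hx, y, hy, rfl⟩
    exact mul_mem hx hy
  inv' := by
    rintro _ ⟨n, rfl⟩
    exact ⟨_, ⟨n, rfl⟩, fun x hx => (ballFixator d k n).inv_mem hx⟩
  conj' := by
    rintro g _ ⟨n, rfl⟩
    obtain ⟨m, hm⟩ := exists_ballFixator_conj g n
    exact ⟨_, ⟨m, rfl⟩, hm⟩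

/-- The group topology of the Neretin group for which the automorphism group of the rooted tree,
with its profinite topology, is an open subgroup. -/
instance (d k : ℕ) : TopologicalSpace (NeretinGroup d k) := (neretinBasis d k).topology

instance (d k : ℕ) : IsTopologicalGroup (NeretinGroup d k) :=
  (neretinBasis d k).isTopologicalGroup

theorem ForestIso.level_apply {n : ℕ} (φ : ForestIso (ball d k n) (ball d k n))
    (v : ↥((ball d k n)ᶜ)) : level (φ v).1 = level v.1 := by
  have hlt : ∀ v : ↥((ball d k n)ᶜ), n < level v.1 := fun v => not_le.1 v.2
  have hpar : ∀ v : ↥((ball d k n)ᶜ), ∃ u, IsParent u v.1 := fun v =>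
    exists_isParent fun h => v.2 (by rw [h]; exact Nat.zero_le n)
  obtain ⟨l, hl⟩ : ∃ l, level v.1 = l := ⟨_, rfl⟩
  induction l generalizing v with
  | zero => have := hlt v; omega
  | succ l ih =>
    obtain ⟨u, hu⟩ := hpar v
    by_cases hun : u ∈ ball d k n
    · obtain ⟨u', hu'⟩ := hpar (φ v)
      have hu'n : u' ∈ ball d k n := by
        by_contra hc
        have h1 : IsParent (φ (RelIso.symm φ ⟨u', hc⟩)).1 (φ v).1 := by
          rwa [RelIso.apply_symm_apply]
        exact (RelIso.symm φ ⟨u', hc⟩).2 (((φ.map_rel_iff.1 h1).unique hu) ▸ hun)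
      have h1 := hlt v
      have h2 := hlt (φ v)
      have h3 := hu.level_eq
      have h4 := hu'.level_eq
      simp only [ball, Set.mem_ofPred_eq] at hun hu'n
      omega
    · have h1 : IsParent (φ ⟨u, hun⟩).1 (φ v).1 := φ.map_rel_iff.2 hu
      have h2 := hu.level_eq
      rw [h1.level_eq, ih ⟨u, hun⟩ (by simp only; omega), h2]

theorem ForestIso.Induces.exists_restrict {m n : ℕ} {φ : ForestIso (ball d k m) (ball d k m)}
    {g : Equiv.Perm (Ends d k)} (hφ : φ.Induces g) (hmn : m ≤ n) :
    ∃ ψ : ForestIso (ball d k n) (ball d k n), ψ.Induces g := by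
  have hsub : ∀ {v}, v ∈ (ball d k n)ᶜ → v ∈ (ball d k m)ᶜ := fun hv h => hv (le_trans h hmn)
  have hmem : ∀ (χ : ForestIso (ball d k m) (ball d k m)) (v : ↥((ball d k n)ᶜ)),
      (χ ⟨v.1, hsub v.2⟩).1 ∈ (ball d k n)ᶜ := fun χ v h => v.2 (by
    exact (χ.level_apply ⟨v.1, hsub v.2⟩).ge.trans h)
  exact ⟨{
    toFun := fun v => ⟨_, hmem φ v⟩
    invFun := fun v => ⟨_, hmem (RelIso.symm φ) v⟩
    left_inv := fun v => by simp
    right_inv := fun v => by simp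
    map_rel_iff' := φ.map_rel_iff }, fun ξ v => hφ ξ ⟨v.1, hsub v.2⟩⟩

/-- The subgroup `O` of the Neretin group: the elements represented by an almost automorphism
`(A, A, φ)` where `A` is a ball around the root. As a subgroup it carries the subspace topology. -/
def subgroupO (d k : ℕ) : Subgroup (NeretinGroup d k) where
  carrier := {g | ∃ (n : ℕ) (φ : ForestIso (ball d k n) (ball d k n)), φ.Induces g.1}
  one_mem' := ⟨0, RelIso.refl _, fun _ _ => Iff.rfl⟩
  mul_mem' := by
    rintro g h ⟨m, φ, hφ⟩ ⟨n, ψ, hψ⟩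
    obtain ⟨φ', hφ'⟩ := hφ.exists_restrict (le_max_left m n)
    obtain ⟨ψ', hψ'⟩ := hψ.exists_restrict (le_max_right m n)
    exact ⟨max m n, ψ'.trans φ', fun ξ v => (hψ' ξ v).trans (hφ' _ _)⟩
  inv_mem' := by
    rintro g ⟨n, φ, hφ⟩
    exact ⟨n, RelIso.symm φ, hφ.symm⟩

end NeretinTree

/-! The group `O` is the increasing union of the open subgroups acting on all vertices at distance
at least `n + 1` from the root. If `O/H` is compact, one of these, say `K`, satisfies `O = H K`. On
a level with `M` vertices, far enough from the root, this reads `Sym = P A`, where `P` is the image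
of `H` and `A` that of `K` (`exists_factorization`). Two features of `A` matter: its order is at
most exponential in `M`, hence below `(M/2)!`, and it preserves the relation of being siblings.

Since `A` is small, Bochert's argument gives a 3-cycle in `P` (`exists_isThreeCycle_mem`). Lying on
a common 3-cycle of `P` generates a `P`-invariant equivalence relation. The number of sibling pairs
that a permutation `σ` sends into one class does not depend on `σ`: writing `σ = p a`, the factor
`a` only reorders sibling pairs, and `p` preserves the classes. This rigidity
(`exchange_of_sum_const`) forces a single class, up to at most one exceptional vertex. So `P`
contains all even permutations, or it fixes one vertex and contains all even permutations of the
others (`exists_subsingleton_of_isThreeCycle_mem`).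

If there is no fixed vertex on infinitely many levels, then `H` is dense, so `H = O`; parity is no
obstacle, since a swap of two siblings deep in the tree is close to the identity
(`mem_of_frequently_even_mem`). Otherwise the fixed vertices of consecutive levels lie on a common
ray (`par_eq_of_fixed`), whose end `ξ` is fixed by `H`, and the same density argument gives `O_ξ ≤
H`.

Conversely, `O` acts transitively on the compact space of ends, and ball fixators realize moves
between nearby ends; so `O/O_ξ` is compact. -/

open Equiv

/-! ### 3-cycles in a permutation group and the equivalence relation they define -/

section ThreeCycles

variable {V : Type*} [DecidableEq V]

/-- The cyclic permutation `x ↦ y ↦ z ↦ x` of three distinct points. -/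
def threeCycle (x y z : V) : Perm V := swap x y * swap y z

theorem threeCycle_inv (x y z : V) : (threeCycle x y z)⁻¹ = threeCycle z y x := by
  simp [threeCycle, swap_comm]

theorem threeCycle_rotate {x y z : V} (hxy : x ≠ y) (hyz : y ≠ z) (hxz : x ≠ z) :
    threeCycle x y z = threeCycle y z x := by
  ext w
  simp only [threeCycle, Perm.mul_apply, swap_apply_def]
  grind

theorem threeCycle_conj (g : Perm V) (x y z : V) :
    g * threeCycle x y z * g⁻¹ = threeCycle (g x) (g y) (g z) := by
  simp only [threeCycle, Equiv.swap_apply_apply]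
  group

theorem threeCycle_apply_left {x y z : V} (hxy : x ≠ y) (hxz : x ≠ z) :
    threeCycle x y z x = y := by
  simp [threeCycle, swap_apply_of_ne_of_ne hxy hxz]

theorem threeCycle_apply_mid {x y z : V} (hyz : y ≠ z) (hxz : x ≠ z) :
    threeCycle x y z y = z := by
  simp [threeCycle, swap_apply_of_ne_of_ne hxz.symm hyz.symm]

theorem threeCycle_apply_right {x y z : V} :
    threeCycle x y z z = x := by
  simp [threeCycle]

theorem threeCycle_apply_of_ne {x y z w : V} (hx : w ≠ x) (hy : w ≠ y) (hz : w ≠ z) :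
    threeCycle x y z w = w := by
  simp [threeCycle, swap_apply_of_ne_of_ne, *]

/-- Two points are related when they are equal or lie on a common `3`-cycle of `P`. -/
def ThreeCycleRel (P : Subgroup (Perm V)) (x y : V) : Prop :=
  x = y ∨ ∃ z, x ≠ y ∧ y ≠ z ∧ x ≠ z ∧ threeCycle x y z ∈ P

variable {P : Subgroup (Perm V)}

theorem threeCycle_mem_rotate {x y z : V} (hxy : x ≠ y) (hyz : y ≠ z) (hxz : x ≠ z)
    (h : threeCycle x y z ∈ P) : threeCycle y z x ∈ P :=
  threeCycle_rotate hxy hyz hxz ▸ h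

theorem threeCycle_mem_reverse {x y z : V} (h : threeCycle x y z ∈ P) : threeCycle z y x ∈ P :=
  threeCycle_inv x y z ▸ P.inv_mem h

theorem threeCycle_mem_conj {g : Perm V} (hg : g ∈ P) {x y z : V} (h : threeCycle x y z ∈ P) :
    threeCycle (g x) (g y) (g z) ∈ P :=
  threeCycle_conj g x y z ▸ P.mul_mem (P.mul_mem hg h) (P.inv_mem hg)

theorem ThreeCycleRel.symm {x y : V} (h : ThreeCycleRel P x y) : ThreeCycleRel P y x := by
  rcases h with rfl | ⟨z, hxy, hyz, hxz, h⟩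
  · exact Or.inl rfl
  · exact Or.inr ⟨z, hxy.symm, hxz, hyz, threeCycle_mem_rotate hyz.symm hxy.symm hxz.symm
      (threeCycle_mem_reverse h)⟩

theorem ThreeCycleRel.trans {x y w : V} (h : ThreeCycleRel P x y) (h' : ThreeCycleRel P y w) :
    ThreeCycleRel P x w := by
  rcases h with rfl | ⟨z, hxy, hyz, hxz, h⟩
  · exact h'
  rcases h' with rfl | ⟨u, hyw, hwu, hyu, h'⟩
  · exact Or.inr ⟨z, hxy, hyz, hxz, h⟩
  by_cases hxw : x = w
  · exact Or.inl hxw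
  right
  by_cases hwz : w = z
  · subst hwz
    exact ⟨y, hxw, hyw.symm, hxy, threeCycle_mem_rotate hxy.symm hxw hyw
      (threeCycle_mem_rotate hyw.symm hxy.symm (Ne.symm hxw) (threeCycle_mem_reverse h))⟩
  -- The cycle `(z y x)` sends `y` to `x` and fixes `w`, so it conjugates `(y w u)` to `(x w _)`.
  · have hg := threeCycle_mem_reverse h
    have h1 := threeCycle_mem_conj hg h'
    rw [threeCycle_apply_mid hxy.symm hxz.symm,
      threeCycle_apply_of_ne hwz hyw.symm (Ne.symm hxw)] at h1
    refine ⟨_, hxw, ?_, ?_, h1⟩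
    · intro h2
      refine hwu ((threeCycle z y x).injective ?_)
      rwa [threeCycle_apply_of_ne hwz hyw.symm (Ne.symm hxw)]
    · intro h2
      refine hyu ((threeCycle z y x).injective ?_)
      rwa [threeCycle_apply_mid hxy.symm hxz.symm]

theorem ThreeCycleRel.map {x y : V} {g : Perm V} (hg : g ∈ P) (h : ThreeCycleRel P x y) :
    ThreeCycleRel P (g x) (g y) := by
  rcases h with rfl | ⟨z, hxy, hyz, hxz, h⟩
  · exact Or.inl rfl
  · exact Or.inr ⟨g z, g.injective.ne hxy, g.injective.ne hyz, g.injective.ne hxz,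
      threeCycle_mem_conj hg h⟩

theorem ThreeCycleRel.map_iff {x y : V} {g : Perm V} (hg : g ∈ P) :
    ThreeCycleRel P (g x) (g y) ↔ ThreeCycleRel P x y :=
  ⟨fun h => by simpa using h.map (P.inv_mem hg), fun h => h.map hg⟩

/-- There is a cycle `(x y u)` in `P`. When `u ≠ z`, transitivity relates `z` to `u` by some `(z u
w)`. If `w` is neither `x` nor `y`, conjugating `(x y u)` by `(w u z)` replaces `u` by `z`. In the
two remaining cases `(z u w)` is conjugated by `(x y u)` or its inverse. -/
theorem ThreeCycleRel.threeCycle_mem {x y z : V} (hxy : x ≠ y) (hyz : y ≠ z) (hxz : x ≠ z)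
    (h : ThreeCycleRel P x y) (h' : ThreeCycleRel P x z) : threeCycle x y z ∈ P := by
  obtain ⟨u, -, hyu, hxu, hu⟩ := h.resolve_left hxy
  by_cases huz : u = z
  · exact huz ▸ hu
  have hxu' : ThreeCycleRel P x u :=
    Or.inr ⟨y, hxu, hyu.symm, hxy, threeCycle_mem_rotate hxy.symm hxu hyu
      (threeCycle_mem_rotate hyu.symm hxy.symm hxu.symm (threeCycle_mem_reverse hu))⟩
  obtain ⟨w, -, huw, hzw, hw⟩ := (h'.symm.trans hxu').resolve_left (Ne.symm huz)
  by_cases hwx : w = x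
  · subst hwx
    have h1 := threeCycle_mem_conj hu hw
    rw [threeCycle_apply_of_ne hxz.symm hyz.symm (Ne.symm huz), threeCycle_apply_right,
      threeCycle_apply_left hxy hxu] at h1
    exact threeCycle_mem_rotate hxz.symm hxy hyz.symm h1
  by_cases hwy : w = y
  · subst hwy
    have h1 := threeCycle_mem_conj (threeCycle_mem_reverse hu) hw
    rw [threeCycle_apply_of_ne (Ne.symm huz) hyz.symm hxz.symm,
      threeCycle_apply_left hyu.symm hxu.symm,
      threeCycle_apply_mid hxy.symm hxu.symm] at h1
    exact threeCycle_mem_reverse h1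
  · have h1 := threeCycle_mem_conj (threeCycle_mem_reverse hw) hu
    rwa [threeCycle_apply_of_ne (Ne.symm hwx) hxu hxz,
      threeCycle_apply_of_ne (Ne.symm hwy) hyu hyz,
      threeCycle_apply_mid huz hzw.symm] at h1

/-- A group that contains all `3`-cycles on a set contains all even permutations of it. -/
theorem mem_of_threeCycle_mem [Fintype V] (p : V → Prop)
    (h : ∀ x y z, p x → p y → p z → x ≠ y → y ≠ z → x ≠ z → threeCycle x y z ∈ P)
    {σ : Perm V} (hσ : ∀ x, ¬ p x → σ x = x) (hs : Perm.sign σ = 1) : σ ∈ P := by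
  classical
  have h₁ : ∀ x, p (σ x) ↔ p x := by
    refine fun x => ⟨fun h => ?_, fun h => ?_⟩ <;> by_contra hx
    · exact hx (hσ x hx ▸ h)
    · exact hx (by rwa [σ.injective (hσ _ hx)])
  have h₂ : ∀ x, σ x ≠ x → p x := fun x hx => by_contra fun hc => hx (hσ x hc)
  have h3 : Perm.ofSubtype (σ.subtypePerm h₁) = σ := Perm.ofSubtype_subtypePerm h₁ h₂
  have h4 : σ.subtypePerm h₁ ∈ alternatingGroup (Subtype p) := by
    rw [Perm.mem_alternatingGroup, ← Perm.sign_ofSubtype, h3, hs]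
  rw [← Perm.closure_three_cycles_eq_alternating] at h4
  have h5 : Subgroup.closure {τ : Perm (Subtype p) | τ.IsThreeCycle} ≤
      P.comap Perm.ofSubtype := by
    rw [Subgroup.closure_le]
    intro τ (hτ : τ.IsThreeCycle)
    obtain ⟨a, ha⟩ : τ.support.Nonempty := by
      rw [← Finset.card_pos, hτ.card_support]; norm_num
    have hn := hτ.nodup_iff_mem_support.2 ha
    simp only [List.nodup_cons, List.mem_cons, List.not_mem_nil, or_false, not_or] at hn
    have he := hτ.eq_swap_mul_swap_iff_mem_support.2 ha
    change Perm.ofSubtype τ ∈ P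
    rw [he, map_mul, Perm.ofSubtype_swap_eq, Perm.ofSubtype_swap_eq]
    exact h _ _ _ a.2 (τ a).2 (τ (τ a)).2 (fun h => hn.1.1 (Subtype.ext h))
      (fun h => hn.2.1 (Subtype.ext h)) (fun h => hn.1.2 (Subtype.ext h))
  have := h5 h4
  rwa [Subgroup.mem_comap, h3] at this

end ThreeCycles

/-! ### Bochert's bound: small index forces a 3-cycle -/

section Bochert

variable {V : Type*} [Fintype V] [DecidableEq V] {P : Subgroup (Perm V)}

/-- If the supports of `g` and `h` meet in a single point, their commutator is a `3`-cycle. -/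
theorem isThreeCycle_commutator {g h : Perm V} {a : V} (hg : g a ≠ a) (hh : h a ≠ a)
    (hgh : ∀ x, x ≠ a → g x = x ∨ h x = x) : (g * h * g⁻¹ * h⁻¹).IsThreeCycle := by
  have hga : h (g a) = g a := (hgh _ hg).resolve_left fun h1 => hg (g.injective h1)
  have hha : g (h a) = h a := (hgh _ hh).resolve_right fun h1 => hh (h.injective h1)
  have hne : g a ≠ h a := fun h1 => hg (g.injective (by rw [← h1] at hha; exact hha))
  -- Among the points moved by `g`, only `a` is moved by `h`; so conjugating `g` by `h` amounts to
  -- conjugating it by the transposition of `a` and `h a`.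
  have key : h * g⁻¹ * h⁻¹ = swap a (h a) * g⁻¹ * swap a (h a) := by
    have h1 : h * g * h⁻¹ = swap a (h a) * g * swap a (h a) := by
      rw [mul_inv_eq_iff_eq_mul]
      ext x
      by_cases hxa : x = a
      · subst hxa
        simp [hga, swap_apply_of_ne_of_ne hg hne]
      · simp only [Perm.mul_apply]
        rcases hgh x hxa with hx | hx
        · have hx1 : h x ≠ h a := h.injective.ne hxa
          by_cases hx2 : h x = a
          · simp [hx, hx2, hha]
          · have : g (h x) = h x := by
              refine (hgh _ hx2).elim id fun h3 => ?_
              rw [h.injective h3, hx]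
            simp [hx, swap_apply_of_ne_of_ne hx2 hx1, this]
        · have hx1 : x ≠ h a := fun h2 => hxa (h.injective (by rw [hx, h2]))
          rw [hx, swap_apply_of_ne_of_ne hxa hx1]
          by_cases hx2 : g x = a
          · simp [hx2]
          · rw [swap_apply_of_ne_of_ne hx2]
            · exact (hgh _ hx2).elim (fun h3 => by rw [g.injective h3, hx]) id
            · intro h3
              exact hx1 (g.injective (by rw [h3, hha]))
    have := congrArg (·⁻¹) h1
    simpa [mul_assoc] using this
  have h2 : g * h * g⁻¹ * h⁻¹ = swap (g a) (h a) * swap a (h a) := by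
    calc g * h * g⁻¹ * h⁻¹ = g * (h * g⁻¹ * h⁻¹) := by group
      _ = (g * swap a (h a) * g⁻¹) * swap a (h a) := by rw [key]; group
      _ = _ := by rw [← Equiv.swap_apply_apply, hha]
  rw [h2, swap_comm (g a), swap_comm a]
  exact Perm.isThreeCycle_swap_mul_swap_same hne.symm hh hg

/-- Bochert's argument: a subgroup of small index in the symmetric group contains a `3`-cycle. -/
theorem exists_isThreeCycle_mem (A : Set (Perm V))
    (hPA : ∀ σ, ∃ p ∈ P, ∃ a ∈ A, σ = p * a) (hA : A.ncard < (Fintype.card V / 2).factorial) :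
    ∃ σ ∈ P, σ.IsThreeCycle := by
  classical
  by_contra! hno
  -- A base is a set whose pointwise stabilizer in `P` is trivial; `D` is a base of least size.
  let IsBase : Finset V → Prop := fun D => ∀ σ ∈ P, (∀ x ∈ D, σ x = x) → σ = 1
  obtain ⟨D, hD, hmin⟩ : ∃ D, IsBase D ∧ ∀ D', IsBase D' → D.card ≤ D'.card := by
    obtain ⟨D, hD, h⟩ := (Finset.univ.filter IsBase).exists_min_image Finset.card
      ⟨Finset.univ, by
        simp only [Finset.mem_filter, Finset.mem_univ, true_and]
        exact fun σ _ h => Equiv.ext fun x => h x (Finset.mem_univ x)⟩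
    exact ⟨D, (Finset.mem_filter.1 hD).2, fun D' hD' => h D' (by simpa using hD')⟩
  -- Otherwise the smaller set `Dᶜ` is not a base, which gives `g ≠ 1` in `P` supported in `D` and
  -- moving some `a`. Neither is `D.erase a`, which gives `h` in `P` fixing all of `D` except `a`.
  -- Their supports meet only in `a`, so their commutator is a 3-cycle.
  have hcard : D.card ≤ Dᶜ.card := by
    by_contra! hlt
    have h1 : ¬ IsBase Dᶜ := fun h => (hmin _ h).not_gt hlt
    simp only [IsBase, not_forall] at h1
    obtain ⟨g, hgP, hg, hg1⟩ := h1
    obtain ⟨a, ha⟩ : ∃ a, g a ≠ a := by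
      by_contra! hc
      exact hg1 (Equiv.ext hc)
    have haD : a ∈ D := by_contra fun hc => ha (hg a (by simpa using hc))
    have h2 : ¬ IsBase (D.erase a) := fun h =>
      (hmin _ h).not_gt (Finset.card_erase_lt_of_mem haD)
    simp only [IsBase, not_forall] at h2
    obtain ⟨h, hhP, hh, hh1⟩ := h2
    have hha : h a ≠ a := fun hc => hh1 (hD h hhP fun x hx => by
      by_cases hxa : x = a
      · rw [hxa, hc]
      · exact hh x (Finset.mem_erase.2 ⟨hxa, hx⟩))
    refine hno _ (P.mul_mem (P.mul_mem (P.mul_mem hgP hhP) (P.inv_mem hgP)) (P.inv_mem hhP))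
      (isThreeCycle_commutator ha hha fun x hxa => ?_)
    by_cases hx : x ∈ D
    · exact Or.inr (hh x (Finset.mem_erase.2 ⟨hxa, hx⟩))
    · exact Or.inl (hg x (by simpa using hx))
  have hhalf : Fintype.card V / 2 ≤ Dᶜ.card := by
    have := D.card_add_card_compl
    omega
  -- `P` meets the permutations of `Dᶜ` trivially, so `|P| * |Dᶜ|! ≤ |Sym V| ≤ |P| * |A|`, against
  -- the bound on `A`.
  have hinj : Function.Injective fun x : P × Perm {v // v ∈ Dᶜ} =>
      (x.1 : Perm V) * Perm.ofSubtype x.2 := by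
    rintro ⟨p, τ⟩ ⟨q, ρ⟩ h
    simp only at h
    have h1 : (q⁻¹ * p : P).1 = Perm.ofSubtype (ρ * τ⁻¹) := by
      rw [map_mul, map_inv, eq_mul_inv_iff_mul_eq, Subgroup.coe_mul, mul_assoc, h]
      simp
    have h2 : (q⁻¹ * p : P).1 = 1 := hD _ (q⁻¹ * p).2 fun x hx => by
      rw [h1, Perm.ofSubtype_apply_of_not_mem]
      simpa using hx
    have h3 : p = q := by
      have : q⁻¹ * p = 1 := Subtype.ext h2
      exact (inv_mul_eq_one.1 this).symm
    subst h3
    have h4 := Perm.ofSubtype_injective (mul_left_cancel h)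
    rw [h4]
  have hsurj : Function.Surjective fun x : P × A => (x.1 : Perm V) * (x.2 : Perm V) := by
    intro σ
    obtain ⟨p, hp, a, ha, rfl⟩ := hPA σ
    exact ⟨(⟨p, hp⟩, ⟨a, ha⟩), rfl⟩
  have c1 := Nat.card_le_card_of_injective _ hinj
  have c2 := Nat.card_le_card_of_surjective _ hsurj
  rw [Nat.card_prod] at c1 c2
  have c3 := Nat.le_of_mul_le_mul_left (c1.trans c2) Nat.card_pos
  rw [Nat.card_perm, Nat.card_eq_fintype_card, Fintype.card_coe] at c3
  have c4 := (Nat.factorial_le hhalf).trans c3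
  rw [Nat.card_coe_set_eq] at c4
  omega

end Bochert

/-! ### Sibling pairs and the dichotomy: all even permutations, or all those fixing one point -/

section Siblings

variable {V U : Type*} [Fintype V] [DecidableEq V]

/-- A symmetric function on pairs whose sum over the pairs of siblings does not change when the
points are permuted satisfies an exchange identity. -/
theorem exchange_of_sum_const [DecidableEq U] (par : V → U) {s s' t t' : V} (hs : s ≠ s')
    (ht : t ≠ t') (hss : par s = par s') (htt : par t = par t') (hst : par s ≠ par t)
    (e : V → V → ℤ) (he : ∀ x, e x x = 1) (hsymm : ∀ x y, e x y = e y x) (N : ℤ)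
    (hN : ∀ σ : Perm V, ∑ x, ∑ y, (if par x = par y then e (σ x) (σ y) else 0) = N)
    {a b c u : V} (hab : a ≠ b) (hac : a ≠ c) (hau : a ≠ u) (hbc : b ≠ c) (hbu : b ≠ u)
    (hcu : c ≠ u) : e a c + e b u = e a u + e b c := by
  have hst1 : s ≠ t := fun h => hst (by rw [h])
  have hst2 : s ≠ t' := fun h => hst (by rw [htt, h])
  have hst3 : s' ≠ t := fun h => hst (by rw [hss, h])
  have hst4 : s' ≠ t' := fun h => hst (by rw [hss, htt, h])
  obtain ⟨σ, h1, h2, h3, h4⟩ : ∃ σ : Perm V, σ s = a ∧ σ s' = c ∧ σ t = b ∧ σ t' = u := by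
    have := (MulAction.isMultiplyPretransitive_iff (G := Perm V) (α := V) (n := 4)).1
      (Perm.isMultiplyPretransitive V 4) ⟨![s, s', t, t'], by
        intro i j; fin_cases i <;> fin_cases j <;> simp [*, Ne.symm, eq_comm]⟩
      ⟨![a, c, b, u], by
        intro i j; fin_cases i <;> fin_cases j <;> simp [*, Ne.symm, eq_comm]⟩
    obtain ⟨σ, hσ⟩ := this
    exact ⟨σ, DFunLike.congr_fun hσ 0, DFunLike.congr_fun hσ 1, DFunLike.congr_fun hσ 2,
      DFunLike.congr_fun hσ 3⟩
  let κ : ℤ := e a c + e b u - e a u - e b c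
  let f : V → ℤ := fun p => (if p = a then 1 else 0) - (if p = b then 1 else 0)
  let g : V → ℤ := fun p => (if p = c then 1 else 0) - (if p = u then 1 else 0)
  -- The second difference of `e` along the two swaps is supported on pairs joining `{a, b}` to `{c,
  -- u}`; there it is `κ` times a product of signs. The claim is that `κ = 0`.
  have hE : ∀ p q, e p q - e (swap a b p) (swap a b q) - e (swap c u p) (swap c u q) +
      e (swap a b (swap c u p)) (swap a b (swap c u q)) = κ * (f p * g q + g p * f q) := by
    intro p q
    have hcase : ∀ p, p = a ∨ p = b ∨ p = c ∨ p = u ∨ (p ≠ a ∧ p ≠ b ∧ p ≠ c ∧ p ≠ u) := by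
      intro p; tauto
    rcases hcase p with rfl | rfl | rfl | rfl | ⟨p1, p2, p3, p4⟩ <;>
    rcases hcase q with rfl | rfl | rfl | rfl | ⟨q1, q2, q3, q4⟩ <;>
    simp only [f, g, κ, swap_apply_def, if_true, if_false, *, Ne.symm,
      ne_eq, not_false_eq_true] <;> grind
  -- Each of the four terms sums to `N` over the sibling pairs, so the alternating sum vanishes.
  have hsum : ∑ x, ∑ y, (if par x = par y then
      κ * (f (σ x) * g (σ y) + g (σ x) * f (σ y)) else 0) = 0 := by
    have e1 := hN σ
    have e2 := hN (swap a b * σ)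
    have e3 := hN (swap c u * σ)
    have e4 := hN (swap a b * swap c u * σ)
    simp only [Perm.mul_apply] at e1 e2 e3 e4
    calc _ = ∑ x, ∑ y, ((if par x = par y then e (σ x) (σ y) else 0)
          - (if par x = par y then e (swap a b (σ x)) (swap a b (σ y)) else 0)
          - (if par x = par y then e (swap c u (σ x)) (swap c u (σ y)) else 0)
          + (if par x = par y then
              e (swap a b (swap c u (σ x))) (swap a b (swap c u (σ y))) else 0)) := by
            refine Finset.sum_congr rfl fun x _ => Finset.sum_congr rfl fun y _ => ?_
            split_ifs
            · rw [hE]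
            · simp
      _ = 0 := by
            simp only [Finset.sum_add_distrib, Finset.sum_sub_distrib]
            rw [e1, e2, e3, e4]; ring
  have hf : ∀ x, f (σ x) = (if x = s then 1 else 0) - (if x = t then 1 else 0) := by
    intro x
    simp only [f, ← h1, ← h3, σ.injective.eq_iff]
  have hg : ∀ x, g (σ x) = (if x = s' then 1 else 0) - (if x = t' then 1 else 0) := by
    intro x
    simp only [g, ← h2, ← h4, σ.injective.eq_iff]
  have key : ∀ F : V → V → ℤ, (∀ x y, F x y = F y x) → ∑ x, ∑ y, F x y *
      (κ * (f (σ x) * g (σ y) + g (σ x) * f (σ y))) =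
      2 * κ * (F s s' - F s t' - F t s' + F t t') := by
    intro F hF
    have h5 : ∀ φ ψ : V → ℤ, ∀ a b c u, (∀ x, φ x = (if x = a then 1 else 0) -
        (if x = b then 1 else 0)) → (∀ x, ψ x = (if x = c then 1 else 0) -
        (if x = u then 1 else 0)) →
        ∑ x, ∑ y, F x y * (φ x * ψ y) = F a c - F a u - F b c + F b u := by
      intro φ ψ a b c u hφ hψ
      simp only [hφ, hψ, mul_sub, mul_ite, mul_one, mul_zero,
        Finset.sum_sub_distrib, Finset.sum_ite_eq', Finset.mem_univ, if_true]
      ring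
    have h6 := h5 (fun x => f (σ x)) (fun x => g (σ x)) _ _ _ _ hf hg
    have h7 := h5 (fun x => g (σ x)) (fun x => f (σ x)) _ _ _ _ hg hf
    calc _ = ∑ x, ∑ y, (κ * (F x y * (f (σ x) * g (σ y))) +
          κ * (F x y * (g (σ x) * f (σ y)))) := by
          refine Finset.sum_congr rfl fun x _ => Finset.sum_congr rfl fun y _ => ?_
          ring
      _ = _ := by
          simp only [Finset.sum_add_distrib, ← Finset.mul_sum]
          rw [h6, h7, hF s' s, hF s' t, hF t' s, hF t' t]
          ring
  -- With `F` the indicator of siblings, only the pairs `s, s'` and `t, t'` contribute, and the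
  -- vanishing sum equals `4 * κ`.
  have h8 := key (fun x y => if par x = par y then 1 else 0) (fun x y => by simp [eq_comm])
  simp only [ite_mul, one_mul, zero_mul] at h8
  rw [hsum, ← hss, ← htt] at h8
  simp [hst, Ne.symm hst] at h8
  simp only [κ] at h8
  omega

/-- A group of permutations that contains a `3`-cycle and acts transitively on the partitions with
the same shape as the partition into siblings contains all even permutations, possibly after
removing a fixed point. -/
theorem exists_subsingleton_of_isThreeCycle_mem {P : Subgroup (Perm V)} (A : Set (Perm V))
    (hPA : ∀ σ, ∃ p ∈ P, ∃ a ∈ A, σ = p * a) (par : V → U)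
    (hpar : ∀ a ∈ A, ∀ x y, par (a x) = par (a y) ↔ par x = par y)
    {s s' t t' : V} (hs : s ≠ s') (ht : t ≠ t') (hss : par s = par s') (htt : par t = par t')
    (hst : par s ≠ par t) (h3 : ∃ σ ∈ P, σ.IsThreeCycle) :
    ∃ F : Set V, F.Subsingleton ∧ (∀ σ ∈ P, ∀ x ∈ F, σ x = x) ∧
      ∀ σ : Perm V, Perm.sign σ = 1 → (∀ x ∈ F, σ x = x) → σ ∈ P := by
  classical
  let e : V → V → ℤ := fun x y => if ThreeCycleRel P x y then 1 else 0
  have hex : ∀ {a b c u : V}, a ≠ b → a ≠ c → a ≠ u → b ≠ c → b ≠ u → c ≠ u →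
      e a c + e b u = e a u + e b c := by
    refine exchange_of_sum_const par hs ht hss htt hst e (fun x => if_pos (Or.inl rfl))
      (fun x y => ?_) (∑ x, ∑ y, (if par x = par y then e x y else 0)) fun σ => ?_
    · have : ThreeCycleRel P x y ↔ ThreeCycleRel P y x := ⟨.symm, .symm⟩
      simp only [e, this]
    · obtain ⟨p, hp, a, ha, rfl⟩ := hPA σ
      refine Fintype.sum_equiv a _ _ fun x => Fintype.sum_equiv a _ _ fun y => ?_
      simp only [e, Perm.mul_apply, ThreeCycleRel.map_iff hp, hpar a ha]
  obtain ⟨τ, hτP, hτ⟩ := h3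
  obtain ⟨x, hx⟩ : τ.support.Nonempty := by
    rw [← Finset.card_pos, hτ.card_support]; norm_num
  have hn := hτ.nodup_iff_mem_support.2 hx
  simp only [List.nodup_cons, List.mem_cons, List.not_mem_nil, or_false, not_or] at hn
  have hx1 : ThreeCycleRel P x (τ x) := Or.inr ⟨τ (τ x), hn.1.1, hn.2.1, hn.1.2, by
    have he := hτ.eq_swap_mul_swap_iff_mem_support.2 hx
    rw [threeCycle, ← he]; exact hτP⟩
  have hx2 : ThreeCycleRel P x (τ (τ x)) := hx1.trans (hx1.map hτP)
  by_cases hall : ∀ y, ThreeCycleRel P x y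
  · refine ⟨∅, Set.subsingleton_empty, by simp, fun σ hσ _ => ?_⟩
    exact mem_of_threeCycle_mem (fun _ => True) (fun a b c _ _ _ hab hbc hac =>
      ThreeCycleRel.threeCycle_mem hab hbc hac ((hall a).symm.trans (hall b))
        ((hall a).symm.trans (hall c))) (by simp) hσ
  push Not at hall
  obtain ⟨y, hy⟩ := hall
  -- A second point `u` outside the class of `x` would turn the exchange identity for `x, y, τ x, u`
  -- into `1 + e y u = 0`.
  have hother : ∀ u, u ≠ y → ThreeCycleRel P x u := by
    intro u huy
    by_contra hu
    have hne : ∀ w v, ThreeCycleRel P x w → ¬ ThreeCycleRel P x v → w ≠ v := by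
      rintro w v hw hv rfl
      exact hv hw
    have := hex (hne x y (Or.inl rfl) hy) hn.1.1 (hne x u (Or.inl rfl) hu)
      (hne _ y hx1 hy).symm huy.symm (hne _ u hx1 hu)
    have hyx : ¬ ThreeCycleRel P y (τ x) := fun h => hy (hx1.trans h.symm)
    simp only [e, if_pos hx1, if_neg hu, if_neg hyx] at this
    split_ifs at this <;> omega
  refine ⟨{y}, Set.subsingleton_singleton, ?_, fun σ hσ hσy => ?_⟩
  · intro p hp z hz
    rw [Set.mem_singleton_iff.1 hz]
    -- If `p` moved `y`, then `p y` would lie in the class of `x` and have a companion `v` there;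
    -- `p⁻¹` would carry it to a companion of `y`, which is alone in its class.
    by_contra hpy
    obtain ⟨v, hv, hvx⟩ : ∃ v, ThreeCycleRel P x v ∧ v ≠ p y := by
      by_cases h : x = p y
      · exact ⟨_, hx1, fun h' => hn.1.1 (h.trans h'.symm)⟩
      · exact ⟨x, Or.inl rfl, h⟩
    have h1 : ThreeCycleRel P v (p y) := hv.symm.trans (hother _ hpy)
    have h2 : ThreeCycleRel P (p⁻¹ v) y := by simpa using h1.map (P.inv_mem hp)
    have h3 : p⁻¹ v ≠ y := fun h => hvx (by rw [← h]; simp)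
    exact hy ((hother _ h3).trans h2)
  · refine mem_of_threeCycle_mem (· ≠ y) (fun a b c ha hb hc hab hbc hac =>
      ThreeCycleRel.threeCycle_mem hab hbc hac ((hother a ha).symm.trans (hother b hb))
        ((hother a ha).symm.trans (hother c hc))) (fun z hz => ?_) hσ
    rw [not_not.1 hz]
    exact hσy y rfl

end Siblings

namespace NeretinTree

variable {d k : ℕ}

/-! ### Ends as sequences of letters -/

section Coordinates

/-- The word of the first `n` letters, the most recent letter standing first. -/
def word (x : ℕ → Fin d) : ℕ → List (Fin d)
  | 0 => []
  | n + 1 => x n :: word x n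

theorem word_eq_iff {x y : ℕ → Fin d} {n : ℕ} : word x n = word y n ↔ ∀ i < n, x i = y i := by
  induction n with
  | zero => simp [word]
  | succ n ih =>
    rw [word, word, List.cons.injEq, ih]
    exact ⟨fun h i hi => (Nat.lt_succ_iff_lt_or_eq.1 hi).elim (h.2 i) fun hi => hi ▸ h.1,
      fun h => ⟨h n n.lt_succ_self, fun i hi => h i (hi.trans n.lt_succ_self)⟩⟩

/-- The end with a given sequence of letters. -/
def endOfLetters (x : Fin k × (ℕ → Fin d)) : Ends d k where
  ray
    | 0 => none
    | n + 1 => some (x.1, word x.2 n)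
  ray_zero := rfl
  isParent_ray
    | 0 => .root _
    | _ + 1 => .cons _ _ _

theorem endOfLetters_bijective : Function.Bijective (endOfLetters : _ → Ends d k) := by
  constructor
  · intro x y h
    have h1 : ∀ n, (endOfLetters x).ray (n + 1) = (endOfLetters y).ray (n + 1) := fun n => by rw [h]
    simp only [endOfLetters, Option.some.injEq, Prod.mk.injEq, word_eq_iff] at h1
    exact Prod.ext (h1 0).1 (funext fun i => (h1 (i + 1)).2 i (Nat.lt_succ_self i))
  · intro ξ
    obtain ⟨i, hi⟩ : ∃ i, ξ.ray 1 = some (i, []) := by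
      have h := ξ.isParent_ray 0
      rw [ξ.ray_zero] at h
      generalize ξ.ray (0 + 1) = v at h ⊢
      cases h
      exact ⟨_, rfl⟩
    have hstep : ∀ n, ∃ a : Fin d, ∀ l, ξ.ray (n + 1) = some (i, l) →
        ξ.ray (n + 2) = some (i, a :: l) := by
      intro n
      have h := ξ.isParent_ray (n + 1)
      have hl := level_ray ξ (n + 1)
      generalize ξ.ray (n + 1) = u at h hl ⊢
      change IsParent u (ξ.ray (n + 2)) at h
      generalize ξ.ray (n + 2) = v at h ⊢
      cases h with
      | root => simp [level] at hl
      | cons j l a =>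
        refine ⟨a, fun l' hl' => ?_⟩
        simp only [Option.some.injEq, Prod.mk.injEq] at hl' ⊢
        exact ⟨hl'.1, by rw [hl'.2]⟩
    choose a ha using hstep
    refine ⟨(i, a), Ends.ext (funext fun n => ?_)⟩
    cases n with
    | zero => exact ξ.ray_zero.symm
    | succ n =>
      symm
      change ξ.ray (n + 1) = some (i, word a n)
      induction n with
      | zero => exact hi
      | succ n ih => exact ha n _ ih

/-- Ends correspond to sequences of letters. -/
noncomputable def letters : Ends d k ≃ Fin k × (ℕ → Fin d) :=
  (Equiv.ofBijective _ endOfLetters_bijective).symm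

theorem ray_succ (ξ : Ends d k) (n : ℕ) :
    ξ.ray (n + 1) = some ((letters ξ).1, word (letters ξ).2 n) := by
  conv_lhs => rw [← letters.symm_apply_apply ξ]
  rfl

variable (d k) in
/-- The vertices at distance `m + 1` from the root, as words. -/
abbrev Level (m : ℕ) : Type := Fin k × (Fin m → Fin d)

/-- The vertex at distance `m + 1` from the root on the ray to an end. -/
noncomputable def proj (m : ℕ) (ξ : Ends d k) : Level d k m :=
  ((letters ξ).1, fun i => (letters ξ).2 i)

theorem proj_eq_iff {m : ℕ} {ξ η : Ends d k} :
    proj m ξ = proj m η ↔ ξ.ray (m + 1) = η.ray (m + 1) := by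
  simp [proj, ray_succ, word_eq_iff, funext_iff, Fin.forall_iff]

theorem proj_eq_of_le {m n : ℕ} (h : m ≤ n) {ξ η : Ends d k} (he : proj n ξ = proj n η) :
    proj m ξ = proj m η := by
  rw [proj_eq_iff] at he ⊢
  exact ray_eq_of_le he (by omega)

theorem ends_eq_of_proj {ξ η : Ends d k} (n : ℕ) (h : ∀ m ≥ n, proj m ξ = proj m η) : ξ = η := by
  refine Ends.ext (funext fun j => ?_)
  exact ray_eq_of_le (proj_eq_iff.1 (h (max n j) (le_max_left _ _))) (by omega)

/-- Replace the first `m` letters of an end. -/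
noncomputable def glue {m : ℕ} (w : Level d k m) (ξ : Ends d k) : Ends d k :=
  letters.symm (w.1, fun i => if h : i < m then w.2 ⟨i, h⟩ else (letters ξ).2 i)

@[simp] theorem proj_glue {m : ℕ} (w : Level d k m) (ξ : Ends d k) : proj m (glue w ξ) = w := by
  simp [proj, glue]

@[simp] theorem glue_glue {m : ℕ} (w w' : Level d k m) (ξ : Ends d k) :
    glue w (glue w' ξ) = glue w ξ := by
  simp only [glue, Equiv.apply_symm_apply]
  congr 2
  ext i
  split_ifs <;> rfl

@[simp] theorem glue_proj {m : ℕ} (ξ : Ends d k) : glue (proj m ξ) ξ = ξ := by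
  rw [glue, Equiv.symm_apply_eq]
  refine Prod.ext rfl (funext fun i => ?_)
  simp [proj]

theorem proj_glue_congr {m j : ℕ} (w w' : Level d k m) {ξ η : Ends d k}
    (hw : w = w') (h : proj j ξ = proj j η) : proj j (glue w ξ) = proj j (glue w' η) := by
  subst hw
  simp only [proj, Prod.mk.injEq, funext_iff] at h
  refine Prod.ext (by simp [proj, glue]) (funext fun i => ?_)
  simp [proj, glue, h.2 i]

variable [NeZero d] [NeZero k]

theorem proj_surjective (m : ℕ) : Function.Surjective (proj (d := d) (k := k) m) := fun w =>
  ⟨glue w (letters.symm (0, 0)), proj_glue _ _⟩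

theorem exists_onRay (v : Vertex d k) : ∃ ξ : Ends d k, OnRay v ξ := by
  match v with
  | none => exact ⟨letters.symm (0, 0), 0, Ends.ray_zero _⟩
  | some (i, l) =>
    have : ∃ x : ℕ → Fin d, word x l.length = l := by
      induction l with
      | nil => exact ⟨0, rfl⟩
      | cons a l ih =>
        obtain ⟨x, hx⟩ := ih
        refine ⟨Function.update x l.length a, ?_⟩
        simp only [List.length_cons, word, Function.update_self, List.cons.injEq, true_and]
        conv_rhs => rw [← hx]
        exact word_eq_iff.2 fun i hi => Function.update_of_ne hi.ne _ _
    obtain ⟨x, hx⟩ := this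
    exact ⟨letters.symm (i, x), l.length + 1, by rw [ray_succ]; simp [hx]⟩

end Coordinates

/-! ### `O` and the ball fixators in terms of permutations of ends -/

section Permutations

theorem TreeAut.level_apply (α : TreeAut d k) (v : Vertex d k) : level (α v) = level v := by
  obtain ⟨l, hl⟩ : ∃ l, level v = l := ⟨_, rfl⟩
  induction l generalizing v with
  | zero =>
    rw [hl]
    by_contra h
    obtain ⟨u, hu⟩ := exists_isParent (v := α v) (by rintro h1; exact h (by rw [h1]; rfl))
    have h1 : IsParent (α.symm u) v := by
      rw [← α.map_rel_iff]; simpa using hu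
    have := h1.level_eq
    omega
  | succ l ih =>
    obtain ⟨u, hu⟩ := exists_isParent (v := v) (by rintro rfl; simp [level] at hl)
    have h1 : IsParent (α u) (α v) := α.map_rel_iff.2 hu
    have := hu.level_eq
    rw [h1.level_eq, ih u (by omega), this]

variable (d k) in
/-- The permutations of the ends that act on the vertices at distance at least `m` from the
root. -/
def levelSubgroup (m : ℕ) : Subgroup (Perm (Ends d k)) where
  carrier := {g | ∀ j ≥ m, ∀ ξ η : Ends d k, (g ξ).ray j = (g η).ray j ↔ ξ.ray j = η.ray j}
  one_mem' _ _ _ _ := Iff.rfl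
  mul_mem' hg hh j hj ξ η := (hg j hj _ _).trans (hh j hj _ _)
  inv_mem' {g} hg j hj ξ η := by
    have := hg j hj (g⁻¹ ξ) (g⁻¹ η)
    simpa using this.symm

theorem levelSubgroup_mono {m n : ℕ} (h : m ≤ n) : levelSubgroup d k m ≤ levelSubgroup d k n :=
  fun _ hg j hj => hg j (h.trans hj)

/-- A map of vertices that preserves levels and is compatible with `g` shows that `g` acts on
levels. -/
theorem ray_eq_iff_of_map {m j : ℕ} (hj : m ≤ j) {g : Perm (Ends d k)}
    (φ : {v : Vertex d k // m ≤ level v} → Vertex d k) (hφ : Function.Injective φ)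
    (hlev : ∀ v, level (φ v) = level v.1) (hg : ∀ ξ v, OnRay v.1 ξ ↔ OnRay (φ v) (g ξ))
    (ξ η : Ends d k) : (g ξ).ray j = (g η).ray j ↔ ξ.ray j = η.ray j := by
  have key : ∀ ξ : Ends d k, (g ξ).ray j = φ ⟨ξ.ray j, by rwa [level_ray]⟩ := by
    intro ξ
    have := (hg ξ ⟨ξ.ray j, by rwa [level_ray]⟩).1 ⟨j, rfl⟩
    rw [onRay_iff, hlev] at this
    simpa only [level_ray] using this
  rw [key, key, hφ.eq_iff, Subtype.mk.injEq]

variable [NeZero d] [NeZero k]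

/-- The action of a permutation of the ends on vertices. -/
noncomputable def vertexMap (g : Perm (Ends d k)) (v : Vertex d k) : Vertex d k :=
  (g (exists_onRay v).choose).ray (level v)

theorem level_vertexMap (g : Perm (Ends d k)) (v : Vertex d k) :
    level (vertexMap g v) = level v := level_ray _ _

theorem ray_vertexMap {m : ℕ} {g : Perm (Ends d k)} (hg : g ∈ levelSubgroup d k m)
    {v : Vertex d k} (hv : m ≤ level v) {ξ : Ends d k} (hξ : ξ.ray (level v) = v) :
    vertexMap g v = (g ξ).ray (level v) :=
  (hg _ hv _ _).2 ((onRay_iff.1 (exists_onRay v).choose_spec).trans hξ.symm)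

theorem vertexMap_inv {m : ℕ} {g : Perm (Ends d k)} (hg : g ∈ levelSubgroup d k m)
    {v : Vertex d k} (hv : m ≤ level v) : vertexMap g⁻¹ (vertexMap g v) = v := by
  obtain ⟨ξ, hξ⟩ := exists_onRay v
  rw [onRay_iff] at hξ
  rw [ray_vertexMap ((levelSubgroup d k m).inv_mem hg) (by rwa [level_vertexMap]) (ξ := g ξ)
    (by rw [level_vertexMap, ray_vertexMap hg hv hξ]), level_vertexMap]
  simpa using hξ

theorem vertexMap_isParent {m : ℕ} {g : Perm (Ends d k)} (hg : g ∈ levelSubgroup d k m)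
    {u v : Vertex d k} (hu : m ≤ level u) (h : IsParent u v) :
    IsParent (vertexMap g u) (vertexMap g v) := by
  obtain ⟨ξ, hξ⟩ := exists_onRay v
  rw [onRay_iff, h.level_eq] at hξ
  have hu' : ξ.ray (level u) = u := (hξ ▸ ξ.isParent_ray (level u)).unique h
  rw [ray_vertexMap hg hu hu', ray_vertexMap hg (ξ := ξ) (by rw [h.level_eq]; omega)
    (by rwa [h.level_eq]), h.level_eq]
  exact (g ξ).isParent_ray _

theorem onRay_vertexMap {m : ℕ} {g : Perm (Ends d k)} (hg : g ∈ levelSubgroup d k m)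
    {v : Vertex d k} (hv : m ≤ level v) (ξ : Ends d k) :
    OnRay v ξ ↔ OnRay (vertexMap g v) (g ξ) := by
  obtain ⟨η, hη⟩ := exists_onRay v
  rw [onRay_iff] at hη
  rw [onRay_iff, onRay_iff, level_vertexMap, ray_vertexMap hg hv hη, hg _ hv, hη]

/-- The bijection of vertices outside a small ball, as a relation isomorphism. -/
noncomputable def vertexIso {m : ℕ} {g : Perm (Ends d k)} (hg : g ∈ levelSubgroup d k m)
    (p : Vertex d k → Prop) (hp : ∀ v, p v → m ≤ level v)
    (hlev : ∀ u v : Vertex d k, level u = level v → p u → p v) :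
    (fun u v : {v // p v} => IsParent u.1 v.1) ≃r (fun u v : {v // p v} => IsParent u.1 v.1) where
  toFun v := ⟨vertexMap g v.1, hlev _ _ (level_vertexMap g v.1).symm v.2⟩
  invFun v := ⟨vertexMap g⁻¹ v.1, hlev _ _ (level_vertexMap g⁻¹ v.1).symm v.2⟩
  left_inv v := Subtype.ext (vertexMap_inv hg (hp _ v.2))
  right_inv v := Subtype.ext (by
    have := vertexMap_inv ((levelSubgroup d k m).inv_mem hg) (hp _ v.2)
    rwa [inv_inv] at this)
  map_rel_iff' {u v} := by
    refine ⟨fun h => ?_, vertexMap_isParent hg (hp _ u.2)⟩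
    have := vertexMap_isParent ((levelSubgroup d k m).inv_mem hg)
      (by simpa [level_vertexMap] using hp _ u.2) h
    simpa [vertexMap_inv hg (hp _ u.2), vertexMap_inv hg (hp _ v.2)] using this

/-- A forest automorphism outside a ball preserves levels, and every vertex lies on a ray, so it
amounts to a compatible action on the levels. The vertices outside the ball of radius `n` are those
of level at least `n + 1`. -/
theorem induces_ball_iff {n : ℕ} {g : Perm (Ends d k)} :
    (∃ φ : ForestIso (ball d k n) (ball d k n), φ.Induces g) ↔ g ∈ levelSubgroup d k (n + 1) := by
  constructor
  · rintro ⟨φ, hφ⟩ j hj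
    refine ray_eq_iff_of_map hj (fun v => (φ ⟨v.1, fun h => ?_⟩).1) ?_ ?_ ?_
    · exact absurd (Nat.lt_of_succ_le v.2) (not_lt.2 h)
    · intro u v h
      exact Subtype.ext (Subtype.mk.inj (φ.injective (Subtype.ext h)))
    · intro v
      exact φ.level_apply _
    · intro ξ v
      exact hφ ξ ⟨v.1, fun h => absurd (Nat.lt_of_succ_le v.2) (not_lt.2 h)⟩
  · intro hg
    refine ⟨vertexIso hg (· ∈ (ball d k n)ᶜ) (fun v hv => ?_) (fun u v h hu => ?_), ?_⟩
    · exact Nat.succ_le_of_lt (not_le.1 hv)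
    · exact fun hv => hu (h.trans_le hv)
    · intro ξ v
      exact onRay_vertexMap hg (Nat.succ_le_of_lt (not_le.1 v.2)) ξ

theorem mem_subgroupO_iff {g : NeretinGroup d k} :
    g ∈ subgroupO d k ↔ ∃ n, g.1 ∈ levelSubgroup d k (n + 1) :=
  exists_congr fun _ => induces_ball_iff

theorem mem_neretinSubgroup {n : ℕ} {g : Perm (Ends d k)} (hg : g ∈ levelSubgroup d k (n + 1)) :
    g ∈ neretinSubgroup d k := by
  obtain ⟨φ, hφ⟩ := induces_ball_iff.2 hg
  exact ⟨_, _, φ, isFiniteRootedSubtree_ball d k n, isFiniteRootedSubtree_ball d k n, hφ⟩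

theorem mem_ballFixator_iff {n : ℕ} {g : NeretinGroup d k} :
    g ∈ ballFixator d k n ↔
      g.1 ∈ levelSubgroup d k n ∧ ∀ ξ : Ends d k, (g.1 ξ).ray n = ξ.ray n := by
  constructor
  · rintro ⟨α, hα, hg⟩
    refine ⟨fun j _ => ray_eq_iff_of_map (Nat.zero_le j) (fun v => α v.1)
      (fun u v h => Subtype.ext (α.injective h)) (fun v => α.level_apply v.1)
      (fun ξ v => hg ξ v.1), fun ξ => ?_⟩
    have h := (hg ξ (ξ.ray n)).1 ⟨n, rfl⟩
    rwa [hα _ (level_ray ξ n).le, onRay_iff, level_ray] at h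
  · rintro ⟨h1, h2⟩
    have h0 : g.1 ∈ levelSubgroup d k 0 := by
      intro j _ ξ η
      by_cases hj : n ≤ j
      · exact h1 j hj ξ η
      · rw [ray_eq_of_le (h2 ξ) (not_le.1 hj).le, ray_eq_of_le (h2 η) (not_le.1 hj).le]
    let β := vertexIso h0 (fun _ => True) (fun _ _ => Nat.zero_le _) (fun _ _ _ _ => trivial)
    let e : {v : Vertex d k // True} ≃ Vertex d k := Equiv.subtypeUnivEquiv fun _ => trivial
    refine ⟨⟨(e.symm.trans β.toEquiv).trans e, fun {u v} =>
      β.map_rel_iff (a := e.symm u) (b := e.symm v)⟩, fun v hv => ?_, fun ξ v => ?_⟩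
    · change vertexMap g.1 v = v
      obtain ⟨ξ, hξ⟩ := exists_onRay v
      rw [onRay_iff] at hξ
      rw [ray_vertexMap h0 (Nat.zero_le _) hξ, ray_eq_of_le (h2 ξ) hv, hξ]
    · exact onRay_vertexMap h0 (Nat.zero_le _) ξ

end Permutations

/-! ### Permutations of a single level and the size of the images of the open subgroups -/

section FiniteLevels

/-- The permutation `g` of the ends acts on the vertices of a level through `σ`. -/
def Acts (m : ℕ) (g : Perm (Ends d k)) (σ : Perm (Level d k m)) : Prop :=
  ∀ ξ, proj m (g ξ) = σ (proj m ξ)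

theorem Acts.mul {m : ℕ} {g h : Perm (Ends d k)} {σ τ : Perm (Level d k m)} (hg : Acts m g σ)
    (hh : Acts m h τ) : Acts m (g * h) (σ * τ) := fun ξ => by
  rw [Perm.mul_apply, hg, hh, Perm.mul_apply]

theorem Acts.inv {m : ℕ} {g : Perm (Ends d k)} {σ : Perm (Level d k m)} (hg : Acts m g σ) :
    Acts m g⁻¹ σ⁻¹ := fun ξ => by
  rw [Perm.eq_inv_iff_eq, ← hg]
  simp

/-- The parent of a vertex that is not a child of the root. -/
def par {m : ℕ} (w : Level d k (m + 1)) : Level d k m := (w.1, fun i => w.2 i.castSucc)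

/-- The child of a vertex with a given last letter. -/
def child {m : ℕ} (w : Level d k m) (a : Fin d) : Level d k (m + 1) := (w.1, Fin.snoc w.2 a)

@[simp] theorem par_child {m : ℕ} (w : Level d k m) (a : Fin d) : par (child w a) = w := by
  simp [par, child]

theorem child_injective {m : ℕ} (w : Level d k m) : Function.Injective (child w) := by
  intro a b h
  have := congrArg (fun v => v.2 (Fin.last m)) h
  simpa [child] using this

theorem eq_of_par_eq {m : ℕ} {w w' : Level d k (m + 1)} (h : par w = par w')
    (h' : w.2 (Fin.last m) = w'.2 (Fin.last m)) : w = w' := by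
  simp only [par, Prod.mk.injEq, funext_iff] at h
  exact Prod.ext h.1 (funext (Fin.lastCases h' h.2))

@[simp] theorem par_proj {m : ℕ} (ξ : Ends d k) : par (proj (m + 1) ξ) = proj m ξ := rfl

/-- Permute the first letters of the ends. -/
noncomputable def lift {m : ℕ} (σ : Perm (Level d k m)) : Perm (Ends d k) where
  toFun ξ := glue (σ (proj m ξ)) ξ
  invFun ξ := glue (σ⁻¹ (proj m ξ)) ξ
  left_inv ξ := by simp
  right_inv ξ := by simp

theorem acts_lift {m : ℕ} (σ : Perm (Level d k m)) : Acts m (lift σ) σ := fun ξ => by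
  simp [lift]

theorem lift_mem {m : ℕ} (σ : Perm (Level d k m)) : lift σ ∈ levelSubgroup d k (m + 1) := by
  have key : ∀ (σ : Perm (Level d k m)) j, m ≤ j → ∀ ξ η : Ends d k, proj j ξ = proj j η →
      proj j (lift σ ξ) = proj j (lift σ η) := fun σ j hj ξ η h =>
    proj_glue_congr _ _ (congrArg σ (proj_eq_of_le hj h)) h
  intro j hj ξ η
  obtain ⟨j, rfl⟩ : ∃ i, j = i + 1 := ⟨j - 1, by omega⟩
  rw [← proj_eq_iff, ← proj_eq_iff]
  refine ⟨fun h => ?_, key σ j (by omega) ξ η⟩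
  have := key σ⁻¹ j (by omega) _ _ h
  have h1 : ∀ ξ, lift σ⁻¹ (lift σ ξ) = ξ := (lift σ).left_inv
  rwa [h1, h1] at this

variable [NeZero d] [NeZero k]

theorem Acts.par_apply {m : ℕ} {g : Perm (Ends d k)} {σ : Perm (Level d k m)}
    {τ : Perm (Level d k (m + 1))} (hg : Acts m g σ) (hg' : Acts (m + 1) g τ)
    (w : Level d k (m + 1)) : par (τ w) = σ (par w) := by
  obtain ⟨ξ, rfl⟩ := proj_surjective (m + 1) w
  rw [← hg', par_proj, par_proj, hg]

theorem exists_acts {n m : ℕ} (hnm : n ≤ m) {g : Perm (Ends d k)}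
    (hg : g ∈ levelSubgroup d k (n + 1)) : ∃ σ, Acts m g σ := by
  have h : ∀ ξ η, proj m (g ξ) = proj m (g η) ↔ proj m ξ = proj m η := fun ξ η => by
    rw [proj_eq_iff, proj_eq_iff]
    exact hg _ (by omega) ξ η
  choose s hs using proj_surjective (d := d) (k := k) m
  have hinj : Function.Injective fun w => proj m (g (s w)) := fun w w' hw => by
    rw [← hs w, ← hs w']
    exact (h _ _).1 hw
  refine ⟨Equiv.ofBijective _ (Finite.injective_iff_bijective.1 hinj), fun ξ => ?_⟩
  exact (h _ _).2 (hs _).symm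

variable (d k) in
/-- The permutations of a level that come from the stabilizer of a higher level. -/
def levelPerms (n m : ℕ) : Set (Perm (Level d k m)) :=
  {σ | ∃ g ∈ levelSubgroup d k (n + 1), Acts m g σ}

theorem par_eq_iff_of_mem_levelPerms {n m : ℕ} (hnm : n ≤ m) {a : Perm (Level d k (m + 1))}
    (ha : a ∈ levelPerms d k n (m + 1)) (x y : Level d k (m + 1)) :
    par (a x) = par (a y) ↔ par x = par y := by
  obtain ⟨g, hg, hga⟩ := ha
  obtain ⟨σ, hσ⟩ := exists_acts hnm hg
  rw [hσ.par_apply hga, hσ.par_apply hga, σ.injective.eq_iff]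

/-- Such a permutation is determined by the one it induces on parents and by the last letter of the
image of each vertex. -/
theorem ncard_levelPerms_succ_le {n m : ℕ} (hnm : n ≤ m) :
    (levelPerms d k n (m + 1)).ncard ≤
      (levelPerms d k n m).ncard * d ^ Fintype.card (Level d k (m + 1)) := by
  have h : ∀ a : levelPerms d k n (m + 1), ∃ b : levelPerms d k n m,
      ∀ w, par (a.1 w) = b.1 (par w) := by
    rintro ⟨a, g, hg, hga⟩
    obtain ⟨σ, hσ⟩ := exists_acts hnm hg
    exact ⟨⟨σ, g, hg, hσ⟩, hσ.par_apply hga⟩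
  choose b hb using h
  have hinj : Function.Injective fun a : levelPerms d k n (m + 1) =>
      (b a, fun w => (a.1 w).2 (Fin.last m)) := by
    intro a a' haa
    simp only [Prod.mk.injEq, funext_iff] at haa
    refine Subtype.ext (Equiv.ext fun w => eq_of_par_eq ?_ (haa.2 w))
    rw [hb, hb, haa.1]
  have := Nat.card_le_card_of_injective _ hinj
  rw [Nat.card_prod, Nat.card_fun] at this
  simpa using this

/-- The base `d ^ 2` survives the induction: a level of `M` vertices is followed by one of `d * M ≥
2 * M`, so the exponent `2 * M + d * M` of `d` is at most `2 * (d * M)`. -/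
theorem ncard_levelPerms_le (hd : 2 ≤ d) {n m : ℕ} (hnm : n ≤ m) :
    (levelPerms d k n m).ncard ≤
      (Fintype.card (Level d k n)).factorial * (d ^ 2) ^ Fintype.card (Level d k m) := by
  induction m, hnm using Nat.le_induction with
  | base =>
    calc _ ≤ Nat.card (Perm (Level d k n)) := Set.ncard_le_card _
      _ = (Fintype.card (Level d k n)).factorial := by rw [Nat.card_perm, Nat.card_eq_fintype_card]
      _ ≤ _ := Nat.le_mul_of_pos_right _ (by positivity)
  | succ m hnm ih =>
    refine (ncard_levelPerms_succ_le hnm).trans ((Nat.mul_le_mul_right _ ih).trans ?_)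
    rw [mul_assoc, ← pow_mul, ← pow_add, ← pow_mul]
    refine Nat.mul_le_mul_left _ (Nat.pow_le_pow_right (by omega) ?_)
    have : Fintype.card (Level d k (m + 1)) = d * Fintype.card (Level d k m) := by
      simp [pow_succ]; ring
    have h2 := Nat.mul_le_mul_right (Fintype.card (Level d k m)) hd
    omega

end FiniteLevels

open Filter in
theorem eventually_mul_pow_lt_factorial_half (C D : ℕ) :
    ∀ᶠ M : ℕ in atTop, C * D ^ M < (M / 2).factorial := by
  have h1 := (FloorSemiring.tendsto_pow_div_factorial_atTop ((D + 1 : ℝ) ^ 2)).const_mul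
    (C * (D + 1 : ℝ))
  rw [mul_zero] at h1
  have h2 : ∀ᶠ N : ℕ in atTop, C * (D + 1) * ((D + 1) ^ 2) ^ N < N.factorial := by
    filter_upwards [h1.eventually_lt_const one_pos] with N hN
    rw [← mul_div_assoc, div_lt_one (by positivity)] at hN
    exact_mod_cast hN
  filter_upwards [(Nat.tendsto_div_const_atTop two_ne_zero).eventually h2] with M hM
  refine lt_of_le_of_lt ?_ hM
  -- From `M ≤ 2 * (M / 2) + 1`; the base `D + 1` replaces `D` to be positive.
  rw [mul_assoc, ← pow_mul, ← pow_succ']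
  refine Nat.mul_le_mul_left _ ((Nat.pow_le_pow_left (Nat.le_succ D) M).trans ?_)
  exact Nat.pow_le_pow_right (Nat.succ_pos D) (by omega)

theorem tendsto_card_level [NeZero k] (hd : 2 ≤ d) :
    Filter.Tendsto (fun m => Fintype.card (Level d k m)) Filter.atTop Filter.atTop := by
  refine Filter.tendsto_atTop_mono (fun m => ?_) Filter.tendsto_id
  have h1 : 0 < k := NeZero.pos k
  have h2 : m < d ^ m := Nat.lt_pow_self hd
  simp only [id, Fintype.card_prod, Fintype.card_fin, Fintype.card_fun]
  nlinarith

/-! ### The image of `H` on a level -/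

section Subgroups

variable [NeZero d] [NeZero k] (H : Subgroup (subgroupO d k))

/-- The group of permutations of a level induced by the elements of `H` that act on it. -/
def levelImage (m : ℕ) : Subgroup (Perm (Level d k m)) where
  carrier := {σ | ∃ h ∈ H, h.1.1 ∈ levelSubgroup d k (m + 1) ∧ Acts m h.1.1 σ}
  one_mem' := ⟨1, H.one_mem, one_mem _, fun _ => rfl⟩
  mul_mem' := by
    rintro σ τ ⟨g, hg, hg', hgσ⟩ ⟨h, hh, hh', hhτ⟩
    exact ⟨g * h, H.mul_mem hg hh, mul_mem hg' hh', hgσ.mul hhτ⟩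
  inv_mem' := by
    rintro σ ⟨g, hg, hg', hgσ⟩
    exact ⟨g⁻¹, H.inv_mem hg, inv_mem hg', hgσ.inv⟩

/-- An element of `O` given by a permutation of the ends. -/
def mkO {n : ℕ} (g : Perm (Ends d k)) (hg : g ∈ levelSubgroup d k (n + 1)) : subgroupO d k :=
  ⟨⟨g, mem_neretinSubgroup hg⟩, mem_subgroupO_iff.2 ⟨n, hg⟩⟩

variable {H}

/-- Factor the lift of `σ` as `h * o`. Since `o` and the lift both act on level `m`, so does `h`. -/
theorem exists_factorization {n m : ℕ} (hnm : n ≤ m)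
    (hH : ∀ g : subgroupO d k, ∃ h ∈ H, ∃ o : subgroupO d k,
      o.1.1 ∈ levelSubgroup d k (n + 1) ∧ g = h * o) (σ : Perm (Level d k m)) :
    ∃ p ∈ levelImage H m, ∃ a ∈ levelPerms d k n m, σ = p * a := by
  obtain ⟨h, hh, o, ho, hg⟩ := hH (mkO (lift σ) (lift_mem σ))
  obtain ⟨a, ha⟩ := exists_acts hnm ho
  have h1 : h.1.1 = lift σ * o.1.1⁻¹ := by
    rw [eq_mul_inv_iff_mul_eq]
    exact (congrArg (fun x => x.1.1) hg).symm
  refine ⟨σ * a⁻¹, ⟨h, hh, ?_, ?_⟩, a, ⟨o.1.1, ho, ha⟩, by group⟩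
  · rw [h1]
    exact mul_mem (lift_mem σ) (inv_mem (levelSubgroup_mono (by omega) ho))
  · rw [h1]
    exact (acts_lift σ).mul ha.inv

theorem eventually_exists_subsingleton (hd : 2 ≤ d) (hk : 2 ≤ k) {n : ℕ}
    (hH : ∀ g : subgroupO d k, ∃ h ∈ H, ∃ o : subgroupO d k,
      o.1.1 ∈ levelSubgroup d k (n + 1) ∧ g = h * o) :
    ∀ᶠ m in Filter.atTop, ∃ F : Set (Level d k m), F.Subsingleton ∧
      (∀ σ ∈ levelImage H m, ∀ x ∈ F, σ x = x) ∧
      ∀ σ : Perm (Level d k m), Perm.sign σ = 1 → (∀ x ∈ F, σ x = x) → σ ∈ levelImage H m := by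
  filter_upwards [(tendsto_card_level (k := k) hd).eventually
    (eventually_mul_pow_lt_factorial_half (Fintype.card (Level d k n)).factorial (d ^ 2)),
    Filter.eventually_ge_atTop (n + 1)] with m hm hnm
  obtain ⟨m, rfl⟩ : ∃ i, m = i + 1 := ⟨m - 1, by omega⟩
  have h3 := exists_isThreeCycle_mem _ (exists_factorization (m := m + 1) (by omega) hH)
    ((ncard_levelPerms_le hd (by omega)).trans_lt hm)
  have h01 : (⟨0, by omega⟩ : Fin d) ≠ ⟨1, by omega⟩ := by simp
  -- The first two children of `w` and of `w'` are the two sibling pairs required.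
  let w : Level d k m := (⟨0, by omega⟩, 0)
  let w' : Level d k m := (⟨1, by omega⟩, 0)
  have hw : w ≠ w' := by simp [w, w']
  exact exists_subsingleton_of_isThreeCycle_mem _
    (exists_factorization (m := m + 1) (by omega) hH) par
    (fun a ha => par_eq_iff_of_mem_levelPerms (by omega) ha)
    ((child_injective w).ne h01) ((child_injective w').ne h01) (by simp) (by simp) (by simpa) h3

end Subgroups

/-! ### Compactness and density -/

section Topology

variable (d k) in
theorem nhds_one_hasBasis : (nhds (1 : subgroupO d k)).HasBasis (fun _ : ℕ => True)
    fun n => {g | g.1 ∈ ballFixator d k n} := by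
  rw [nhds_subtype_eq_comap]
  refine (((neretinBasis d k).nhds_one_hasBasis).comap _).to_hasBasis ?_ ?_
  · rintro _ ⟨n, rfl⟩
    exact ⟨n, trivial, fun _ h => h⟩
  · intro n _
    exact ⟨_, ⟨n, rfl⟩, fun _ h => h⟩

theorem mem_of_isClosed {H : Subgroup (subgroupO d k)} (hH : IsClosed (H : Set (subgroupO d k)))
    {g : subgroupO d k} (hg : ∀ n, ∃ h ∈ H, (h⁻¹ * g).1 ∈ ballFixator d k n) : g ∈ H := by
  change g ∈ (H : Set (subgroupO d k))
  rw [← hH.closure_eq, mem_closure_iff_nhds]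
  intro U hU
  -- This map sends `h⁻¹ * g` to `h`, so an `h` with `h⁻¹ * g` near `1` lies in `U`.
  have h1 : (fun x => g * x⁻¹) ⁻¹' U ∈ nhds (1 : subgroupO d k) := by
    refine ContinuousAt.preimage_mem_nhds (by fun_prop) ?_
    simpa using hU
  obtain ⟨n, -, hn⟩ := (nhds_one_hasBasis d k).mem_iff.1 h1
  obtain ⟨h, hh, hhg⟩ := hg n
  refine ⟨h, ?_, hh⟩
  have := hn hhg
  simpa using this

variable [NeZero d] [NeZero k]

theorem mem_ballFixator_of {n : ℕ} {g : NeretinGroup d k} (hg : g.1 ∈ levelSubgroup d k (n + 1))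
    (h : ∀ ξ : Ends d k, (g.1 ξ).ray n = ξ.ray n) : g ∈ ballFixator d k n := by
  refine mem_ballFixator_iff.2 ⟨fun j hj ξ η => ?_, h⟩
  rcases hj.eq_or_lt with rfl | hj
  · rw [h, h]
  · exact hg j hj ξ η

/-- The open subgroups `K n` increase to `O`, so their images form a directed open cover of the
compact quotient and one of them is everything. -/
theorem exists_factorization_of_compactSpace (H : Subgroup (subgroupO d k))
    [CompactSpace (subgroupO d k ⧸ H)] : ∃ n, ∀ g : subgroupO d k, ∃ h ∈ H, ∃ o : subgroupO d k,
      o.1.1 ∈ levelSubgroup d k (n + 1) ∧ g = h * o := by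
  let K : ℕ → Subgroup (subgroupO d k) := fun n => (levelSubgroup d k (n + 1)).comap
    ((neretinSubgroup d k).subtype.comp (subgroupO d k).subtype)
  have hK : ∀ n, IsOpen (K n : Set (subgroupO d k)) := fun n => by
    refine Subgroup.isOpen_of_mem_nhds (g := 1) _ ((nhds_one_hasBasis d k).mem_iff.2
      ⟨n, trivial, fun g hg => ?_⟩)
    exact levelSubgroup_mono n.le_succ (mem_ballFixator_iff.1 hg).1
  obtain ⟨n, hn⟩ := isCompact_univ.elim_directed_cover
    (fun n => (QuotientGroup.mk '' (K n : Set (subgroupO d k)) : Set (subgroupO d k ⧸ H)))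
    (fun n => QuotientGroup.isOpenMap_coe _ (hK n))
    (by
      intro x _
      obtain ⟨g, rfl⟩ := QuotientGroup.mk_surjective x
      obtain ⟨n, hn⟩ := mem_subgroupO_iff.1 g.2
      exact Set.mem_iUnion.2 ⟨n, g, hn, rfl⟩)
    (Monotone.directed_le fun m n hmn =>
      Set.image_mono fun g hg => levelSubgroup_mono (Nat.succ_le_succ hmn) hg)
  refine ⟨n, fun g => ?_⟩
  -- The quotient is by left cosets, so `g⁻¹` is used to get the factor from `H` on the left.
  obtain ⟨o, ho, hog⟩ := hn (Set.mem_univ (QuotientGroup.mk g⁻¹))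
  refine ⟨_, H.inv_mem (QuotientGroup.eq.1 hog), o⁻¹, (K n).inv_mem ho, by group⟩

/-- A closed subgroup that realizes the even permutations of levels that fix certain vertices
contains the elements of `O` that fix these vertices. -/
theorem mem_of_frequently_even_mem (hd : 2 ≤ d) (hk : 2 ≤ k) {H : Subgroup (subgroupO d k)}
    (hH : IsClosed (H : Set (subgroupO d k))) (F : ∀ m, Set (Level d k m))
    (hF : ∀ m, (F m).Subsingleton)
    (hfreq : ∃ᶠ m in Filter.atTop, ∀ σ : Perm (Level d k m), Perm.sign σ = 1 →
      (∀ x ∈ F m, σ x = x) → σ ∈ levelImage H m)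
    {g : subgroupO d k} (hg : ∀ᶠ m in Filter.atTop, ∀ ξ : Ends d k, proj m ξ ∈ F m →
      proj m (g.1.1 ξ) = proj m ξ) : g ∈ H := by
  refine mem_of_isClosed hH fun n => ?_
  obtain ⟨n', hn'⟩ := mem_subgroupO_iff.1 g.2
  obtain ⟨m, hm, hgm, hmn⟩ := (hfreq.and_eventually
    (hg.and (Filter.eventually_ge_atTop (max n n' + 1)))).exists
  obtain ⟨m, rfl⟩ : ∃ i, m = i + 1 := ⟨m - 1, by omega⟩
  have hgm' := levelSubgroup_mono (show n' + 1 ≤ m + 1 + 1 by omega) hn'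
  obtain ⟨σ, hσ⟩ := exists_acts (show n' ≤ m + 1 by omega) hn'
  have hσF : ∀ x ∈ F (m + 1), σ x = x := by
    intro x hx
    obtain ⟨ξ, rfl⟩ := proj_surjective _ x
    rw [← hσ, hgm ξ hx]
  -- `τ` corrects the sign of `σ`. It is trivial or swaps two siblings away from `F`, so its lift
  -- fixes the ball of radius `m + 1`.
  obtain ⟨τ, hτσ, hτF, hτ⟩ : ∃ τ : Perm (Level d k (m + 1)), Perm.sign (σ * τ) = 1 ∧
      (∀ x ∈ F (m + 1), τ x = x) ∧ ∀ x, par (τ x) = par x := by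
    rcases Int.units_eq_one_or (Perm.sign σ) with h | h
    · exact ⟨1, by simpa using h, fun _ _ => rfl, fun _ => rfl⟩
    obtain ⟨w, hw⟩ : ∃ w : Level d k m, ∀ x ∈ F (m + 1), par x ≠ w := by
      let w : Level d k m := (⟨0, by omega⟩, 0)
      let w' : Level d k m := (⟨1, by omega⟩, 0)
      have hww : w ≠ w' := by simp [w, w']
      by_contra! hc
      obtain ⟨x, hx, hxw⟩ := hc w
      obtain ⟨y, hy, hyw⟩ := hc w'
      exact hww (by rw [← hxw, ← hyw, hF _ hx hy])
    have h01 : (⟨0, by omega⟩ : Fin d) ≠ ⟨1, by omega⟩ := by simp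
    refine ⟨swap (child w ⟨0, by omega⟩) (child w ⟨1, by omega⟩), ?_, fun x hx => ?_, fun x => ?_⟩
    · rw [map_mul, h, Perm.sign_swap ((child_injective w).ne h01)]
      rfl
    · refine swap_apply_of_ne_of_ne ?_ ?_ <;>
      · rintro rfl
        exact hw _ hx (by simp)
    · rw [swap_apply_def]
      split_ifs with h1 h2
      · simp [h1]
      · simp [h2]
      · rfl
  obtain ⟨h, hh, hhm, hhσ⟩ := hm (σ * τ) hτσ fun x hx => by
    rw [Perm.mul_apply, hτF x hx, hσF x hx]
  refine ⟨h, hh, ?_⟩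
  let t : subgroupO d k := mkO (lift τ) (lift_mem τ)
  have ht : t.1 ∈ ballFixator d k (m + 1) := by
    refine mem_ballFixator_of (lift_mem τ) fun ξ => ?_
    rw [← proj_eq_iff]
    exact (congrArg par (acts_lift τ ξ)).trans (hτ _)
  -- `h` and `g * t` both act on `Level d k (m + 1)`, at distance `m + 2` from the root, as `σ * τ`.
  have h1 : (h⁻¹ * g * t).1 ∈ ballFixator d k (m + 1 + 1) := by
    have h2 : (h⁻¹ * g * t).1.1 ∈ levelSubgroup d k (m + 1 + 1) :=
      mul_mem (mul_mem (inv_mem hhm) hgm') (lift_mem τ)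
    refine mem_ballFixator_of (levelSubgroup_mono (Nat.le_succ _) h2) fun ξ => ?_
    rw [← proj_eq_iff]
    refine ((hhσ.inv.mul hσ).mul (acts_lift τ) ξ).trans ?_
    rw [mul_assoc, inv_mul_cancel]
    rfl
  have h3 : (h⁻¹ * g).1 = (h⁻¹ * g * t).1 * t.1⁻¹ := by
    simp
  rw [h3]
  exact mul_mem (ballFixator_anti (by omega) h1) (inv_mem (ballFixator_anti (by omega) ht))

end Topology

/-! ### Transitivity on ends -/

section Transitivity

/-- Permute the letters of the ends, position by position. -/
noncomputable def letterPerm (s : Perm (Fin k)) (σ : ℕ → Perm (Fin d)) : Perm (Ends d k) :=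
  (letters.trans (Equiv.prodCongr s (Equiv.piCongrRight σ))).trans letters.symm

theorem letters_letterPerm (s : Perm (Fin k)) (σ : ℕ → Perm (Fin d)) (ξ : Ends d k) :
    letters (letterPerm s σ ξ) = (s (letters ξ).1, fun i => σ i ((letters ξ).2 i)) := by
  simp only [letterPerm, Equiv.trans_apply, Equiv.apply_symm_apply]
  rfl

theorem letterPerm_mem (s : Perm (Fin k)) (σ : ℕ → Perm (Fin d)) :
    letterPerm s σ ∈ levelSubgroup d k 0 := by
  rintro (_ | j) - ξ η
  · simp [Ends.ray_zero]
  · rw [← proj_eq_iff, ← proj_eq_iff]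
    simp [proj, letters_letterPerm, funext_iff]

variable [NeZero d] [NeZero k]

/-- The fixator of a ball acts transitively on the ends that leave the ball at the same vertex. -/
theorem exists_ballFixator_apply_eq {n : ℕ} {ξ η : Ends d k} (h : ξ.ray n = η.ray n) :
    ∃ g : subgroupO d k, g.1 ∈ ballFixator d k n ∧ g.1.1 ξ = η := by
  -- In the positions where `ξ` and `η` agree the swap is trivial, so their common initial segment
  -- costs nothing.
  let g : Perm (Ends d k) := letterPerm (swap (letters ξ).1 (letters η).1)
    (fun i => swap ((letters ξ).2 i) ((letters η).2 i))
  have hg : g ∈ levelSubgroup d k 0 := letterPerm_mem _ _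
  refine ⟨mkO (n := 0) g (levelSubgroup_mono (Nat.zero_le _) hg), ?_, ?_⟩
  · refine mem_ballFixator_iff.2 ⟨levelSubgroup_mono (Nat.zero_le _) hg, fun ζ => ?_⟩
    change (g ζ).ray n = ζ.ray n
    cases n with
    | zero => rw [Ends.ray_zero, Ends.ray_zero]
    | succ n =>
      rw [← proj_eq_iff] at h ⊢
      simp only [proj, Prod.mk.injEq, funext_iff] at h
      refine Prod.ext ?_ (funext fun i => ?_)
      · simp [proj, g, letters_letterPerm, h.1]
      · simp [proj, g, letters_letterPerm, h.2 i]
  · change g ξ = η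
    apply letters.injective
    simp [g, letters_letterPerm]

end Transitivity

/-! ### Stabilizers of ends are proper, closed and cocompact -/

section Stabilizers

variable [NeZero d] [NeZero k]

theorem stabilizer_ne_top (hk : 2 ≤ k) (ξ : Ends d k) :
    MulAction.stabilizer (subgroupO d k) ξ ≠ ⊤ := by
  intro h
  have : Nontrivial (Fin k) := Fin.nontrivial_iff_two_le.2 hk
  obtain ⟨w, hw⟩ := exists_ne (letters ξ).1
  let η : Ends d k := letters.symm (w, (letters ξ).2)
  obtain ⟨g, -, hg⟩ := exists_ballFixator_apply_eq (n := 0) (ξ := ξ) (η := η)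
    (by rw [Ends.ray_zero, Ends.ray_zero])
  have h1 : g.1.1 ξ = ξ := by
    have : g ∈ MulAction.stabilizer (subgroupO d k) ξ := h ▸ Subgroup.mem_top g
    exact this
  have h2 := congrArg (fun ζ => (letters ζ).1) (hg.symm.trans h1)
  simp [η] at h2
  exact hw h2

theorem isClosed_stabilizer (ξ : Ends d k) :
    IsClosed (MulAction.stabilizer (subgroupO d k) ξ : Set (subgroupO d k)) := by
  refine ⟨isOpen_iff_mem_nhds.2 fun g hg => ?_⟩
  have hg' : g.1.1 ξ ≠ ξ := hg
  obtain ⟨n, hn⟩ : ∃ n, (g.1.1 ξ).ray n ≠ ξ.ray n := by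
    by_contra! hc
    exact hg' (Ends.ext (funext hc))
  have h1 : (fun x => x * g⁻¹) ⁻¹' {u : subgroupO d k | u.1 ∈ ballFixator d k n} ∈ nhds g := by
    refine ContinuousAt.preimage_mem_nhds (by fun_prop) ?_
    rw [mul_inv_cancel]
    exact (nhds_one_hasBasis d k).mem_of_mem trivial
  refine Filter.mem_of_superset h1 fun x hx hxs => hn ?_
  have h2 := (mem_ballFixator_iff.1 hx).2 (g.1.1 ξ)
  have h3 : (x * g⁻¹).1.1 (g.1.1 ξ) = x.1.1 ξ := by simp
  have h4 : x.1.1 ξ = ξ := hxs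
  rw [← h2, h3, h4]

/-- The quotient is a continuous image of the compact space of letter sequences: `x` goes to the
coset of any element carrying `ξ` to the end `x`. Continuity holds because an end close to `x` is
reached from it by an element of a small ball fixator. -/
theorem compactSpace_quotient_stabilizer (ξ : Ends d k) :
    CompactSpace (subgroupO d k ⧸ MulAction.stabilizer (subgroupO d k) ξ) := by
  have htrans : ∀ x : Fin k × (ℕ → Fin d), ∃ g : subgroupO d k, g.1.1 ξ = letters.symm x := by
    intro x
    obtain ⟨g, -, hg⟩ := exists_ballFixator_apply_eq (n := 0) (ξ := ξ) (η := letters.symm x)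
      (by rw [Ends.ray_zero, Ends.ray_zero])
    exact ⟨g, hg⟩
  choose γ hγ using htrans
  have hmk : ∀ g h : subgroupO d k, g.1.1 ξ = h.1.1 ξ →
      (QuotientGroup.mk g : subgroupO d k ⧸ MulAction.stabilizer (subgroupO d k) ξ) =
        QuotientGroup.mk h := by
    intro g h hgh
    refine QuotientGroup.eq.2 ?_
    change g.1.1⁻¹ (h.1.1 ξ) = ξ
    rw [← hgh]
    simp
  have hcont : Continuous fun x =>
      (QuotientGroup.mk (γ x) : subgroupO d k ⧸ MulAction.stabilizer (subgroupO d k) ξ) := by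
    refine continuous_iff_continuousAt.2 fun x U hU => ?_
    have h1 : (fun u : subgroupO d k => (QuotientGroup.mk (u * γ x) :
        subgroupO d k ⧸ MulAction.stabilizer (subgroupO d k) ξ)) ⁻¹' U ∈ nhds 1 := by
      refine ContinuousAt.preimage_mem_nhds
        (Continuous.continuousAt (QuotientGroup.continuous_mk.comp (by fun_prop))) ?_
      rwa [one_mul]
    obtain ⟨n, -, hn⟩ := (nhds_one_hasBasis d k).mem_iff.1 h1
    have h2 : IsOpen ((fun y : Fin k × (ℕ → Fin d) =>
        ((y.1, fun i => y.2 i) : Level d k n)) ⁻¹' {proj n (letters.symm x)}) :=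
      (isOpen_discrete _).preimage (by fun_prop)
    refine Filter.mem_map.2 (Filter.mem_of_superset (h2.mem_nhds (x := x) (by simp [proj]))
      fun y hy => ?_)
    have h3 : proj n (letters.symm x) = proj n (letters.symm y) := by
      rw [← Set.mem_singleton_iff.1 hy]
      simp [proj]
    obtain ⟨u, hu, huy⟩ := exists_ballFixator_apply_eq
      (ray_eq_of_le (proj_eq_iff.1 h3) n.le_succ)
    have h4 : (u * γ x).1.1 ξ = (γ y).1.1 ξ := by
      rw [hγ y, ← huy, ← hγ x]
      rfl
    change QuotientGroup.mk (γ y) ∈ U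
    rw [← hmk _ _ h4]
    exact hn hu
  refine Function.Surjective.compactSpace hcont fun q => ?_
  obtain ⟨g, rfl⟩ := QuotientGroup.mk_surjective q
  exact ⟨letters (g.1.1 ξ), hmk _ _ (by rw [hγ, Equiv.symm_apply_apply])⟩

end Stabilizers

/-! ### From fixed vertices to a fixed end -/

section Cocompact

variable [NeZero d] [NeZero k]

/-- Vertices of consecutive levels that are fixed by a large group lie on a common ray. -/
theorem par_eq_of_fixed (hd : 2 ≤ d) (hk : 2 ≤ k) {H : Subgroup (subgroupO d k)} {m : ℕ}
    (hm : 1 ≤ m) {y : Level d k m} {y' : Level d k (m + 1)}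
    (hy : ∀ σ : Perm (Level d k m), Perm.sign σ = 1 → σ y = y → σ ∈ levelImage H m)
    (hy' : ∀ σ ∈ levelImage H (m + 1), σ y' = y') : par y' = y := by
  by_contra hne
  -- Room for `y`, `par y'` and two more vertices `a`, `b`. The 3-cycle of `par y'`, `a`, `b` fixes
  -- `y`, so it comes from an element of `H`; that element moves the parent of `y'` and hence `y'`
  -- itself.
  have hcard : 4 ≤ Fintype.card (Level d k m) := by
    have h1 : 2 ^ 1 ≤ d ^ m := (Nat.pow_le_pow_left hd 1).trans (Nat.pow_le_pow_right (by omega) hm)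
    simp only [Fintype.card_prod, Fintype.card_fin, Fintype.card_fun]
    nlinarith
  have hfin : ∀ s : Finset (Level d k m), s.card ≤ 3 → ∃ a, a ∉ s := fun s hs => by
    by_contra! hc
    rw [Finset.eq_univ_iff_forall.2 hc, Finset.card_univ] at hs
    omega
  obtain ⟨a, ha⟩ := hfin {y, par y'} (Finset.card_le_two.trans (by norm_num))
  obtain ⟨b, hb⟩ := hfin {y, par y', a} Finset.card_le_three
  simp only [Finset.mem_insert, Finset.mem_singleton, not_or] at ha hb
  have hmem : threeCycle (par y') a b ∈ levelImage H m := by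
    refine hy _ ?_ (threeCycle_apply_of_ne (Ne.symm hne) (Ne.symm ha.1) (Ne.symm hb.1))
    rw [threeCycle, map_mul, Perm.sign_swap (Ne.symm ha.2), Perm.sign_swap (Ne.symm hb.2.2)]
    rfl
  obtain ⟨h, hh, hhm, hhσ⟩ := hmem
  obtain ⟨τ, hτ⟩ := exists_acts m.le_succ hhm
  have h1 := hhσ.par_apply hτ y'
  rw [hy' τ ⟨h, hh, levelSubgroup_mono (Nat.le_succ _) hhm, hτ⟩,
    threeCycle_apply_left (Ne.symm ha.2) (Ne.symm hb.2.1)] at h1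
  exact ha.2 h1.symm

theorem exists_end_of_par_eq {n : ℕ} (y : ∀ m, Level d k m) (hy : ∀ m ≥ n, par (y (m + 1)) = y m) :
    ∃ ξ : Ends d k, ∀ m ≥ n, proj m ξ = y m := by
  choose η hη using fun m => proj_surjective m (y m)
  have hstep : ∀ m ≥ n, ∀ j ≥ m, proj m (η j) = proj m (η m) := by
    intro m hm j hj
    induction j, hj using Nat.le_induction with
    | base => rfl
    | succ j hj ih =>
      rw [← ih]
      refine proj_eq_of_le hj ?_
      rw [← par_proj, hη, hy j (hm.trans hj), hη]
  -- Letter `i` is read off at level `n + i + 1`, which is at least `n` and already determines that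
  -- letter.
  refine ⟨letters.symm ((letters (η n)).1, fun i => (letters (η (n + i + 1))).2 i),
    fun m hm => ?_⟩
  rw [← hη m]
  refine Prod.ext ?_ (funext fun i => ?_)
  · simpa [proj] using (congrArg Prod.fst (hstep n le_rfl m hm)).symm
  · simp only [proj, Equiv.apply_symm_apply]
    rcases le_total m (n + i + 1) with h | h
    · exact congrFun (congrArg Prod.snd (hstep m hm _ h)) i
    · exact (congrFun (congrArg Prod.snd (hstep (n + i + 1) (by omega) m h))
        ⟨i, by omega⟩).symm

theorem exists_eq_stabilizer (hd : 2 ≤ d) (hk : 2 ≤ k) {H : Subgroup (subgroupO d k)}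
    (hne : H ≠ ⊤) (hH : IsClosed (H : Set (subgroupO d k)))
    [CompactSpace (subgroupO d k ⧸ H)] :
    ∃ ξ : Ends d k, H = MulAction.stabilizer (subgroupO d k) ξ := by
  obtain ⟨n, hn⟩ := exists_factorization_of_compactSpace H
  have hev := eventually_exists_subsingleton hd hk hn
  have hnf : ¬ ∃ᶠ m in Filter.atTop, ∀ σ : Perm (Level d k m), Perm.sign σ = 1 →
      (∀ x ∈ (∅ : Set (Level d k m)), σ x = x) → σ ∈ levelImage H m := fun hf =>
    hne (eq_top_iff.2 fun g _ => mem_of_frequently_even_mem hd hk hH (fun _ => ∅)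
      (fun _ => Set.subsingleton_empty) hf (by simp))
  rw [Filter.not_frequently] at hnf
  obtain ⟨N, hN⟩ := Filter.eventually_atTop.1 (hev.and hnf)
  have hex : ∀ m, ∃ y : Level d k m, m ≥ N → (∀ σ ∈ levelImage H m, σ y = y) ∧
      ∀ σ : Perm (Level d k m), Perm.sign σ = 1 → σ y = y → σ ∈ levelImage H m := by
    intro m
    by_cases hm : m ≥ N
    · obtain ⟨⟨F, hF, h1, h2⟩, h3⟩ := hN m hm
      rcases hF.eq_empty_or_singleton with rfl | ⟨y, rfl⟩
      · exact absurd h2 h3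
      · exact ⟨y, fun _ => ⟨fun σ hσ => h1 σ hσ y rfl, fun σ hs hσ => h2 σ hs (by simpa)⟩⟩
    -- Below `N` the value is arbitrary.
    · exact ⟨(0, 0), fun h => absurd h hm⟩
  choose y hy using hex
  -- Starting at `N + 1` ensures `1 ≤ m`, needed to have four vertices on the level.
  obtain ⟨ξ, hξ⟩ := exists_end_of_par_eq (n := N + 1) y fun m hm =>
    par_eq_of_fixed hd hk (by omega) (hy m (by omega)).2 (hy (m + 1) (by omega)).1
  refine ⟨ξ, le_antisymm (fun h hh => ?_) fun g hg => ?_⟩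
  · obtain ⟨n', hn'⟩ := mem_subgroupO_iff.1 h.2
    change h.1.1 ξ = ξ
    refine ends_eq_of_proj (max n' (N + 1)) fun m hm => ?_
    obtain ⟨σ, hσ⟩ := exists_acts (show n' ≤ m by omega) hn'
    rw [hσ, hξ m (by omega)]
    exact (hy m (by omega)).1 σ ⟨h, hh, levelSubgroup_mono (by omega) hn', hσ⟩
  -- An element fixing `ξ` fixes `y m`, the vertex of `ξ`, on every level far enough out on which it
  -- acts, so the density argument applies with `F m = {y m}`.
  · refine mem_of_frequently_even_mem hd hk hH (fun m => {y m})
      (fun _ => Set.subsingleton_singleton) (Filter.Eventually.frequently ?_) ?_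
    · filter_upwards [Filter.eventually_ge_atTop N] with m hm σ hs hσ
      exact (hy m hm).2 σ hs (hσ _ rfl)
    · have hg' : g.1.1 ξ = ξ := hg
      obtain ⟨n', hn'⟩ := mem_subgroupO_iff.1 g.2
      filter_upwards [Filter.eventually_ge_atTop (max n' (N + 1))] with m hm η hη
      obtain ⟨σ, hσ⟩ := exists_acts (show n' ≤ m by omega) hn'
      have h1 : proj m η = proj m ξ := by rw [Set.mem_singleton_iff.1 hη, hξ m (by omega)]
      rw [hσ, h1, ← hσ, hg']

end Cocompact

end NeretinTree

theorem mainTheorem10 (d k : ℕ) (hd : 2 ≤ d) (hk : 2 ≤ k)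
    (H : Subgroup ↥(NeretinTree.subgroupO d k)) :
    (H ≠ ⊤ ∧ IsClosed (H : Set ↥(NeretinTree.subgroupO d k)) ∧
        CompactSpace (↥(NeretinTree.subgroupO d k) ⧸ H)) ↔
      ∃ ξ : NeretinTree.Ends d k, H = MulAction.stabilizer ↥(NeretinTree.subgroupO d k) ξ := by
  have : NeZero d := ⟨by omega⟩
  have : NeZero k := ⟨by omega⟩
  constructor
  · rintro ⟨hne, hH, hc⟩
    exact NeretinTree.exists_eq_stabilizer hd hk hne hH
  · rintro ⟨ξ, rfl⟩
    exact ⟨NeretinTree.stabilizer_ne_top hk ξ, NeretinTree.isClosed_stabilizer ξ,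
      NeretinTree.compactSpace_quotient_stabilizer ξ⟩
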